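/- **Setting.** Let $T\in\mathbb N$ and let $W=(W_t)_{0\le t\le T}$ be a real-valued square-integrable martingale on a filtered probability space $(\Omega,\mathcal F,(\mathcal F_t)_{0\le t\le T},P)$, where $\mathcal F_t$ is the $P$-completion of $\sigma(W_s:s\le t)$, $\mathcal F_0$ is trivial up to null sets and $\mathcal F=\mathcal F_T$. Write $\Delta U_t=U_{t+1}-U_t$. Assume that, for $0\le t\le T-1$, $\Delta W_t$ is independent of $\mathcal F_t$ and $\mathbb E[(\Delta W_t)^2]=1$. Let $\mathcal M^2(0,s;\mathbb R^k)$ be the set of adapted square-integrable $\mathbb R^k$-valued processes on $\{0,\dots,s\}$. Let $x_0\in\mathbb R^m$, let $b,\sigma:\Omega\times\{0,\dots,T-1\}\times\mathbb R^m\times\mathbb R^n\times\mathbb R^n\to\mathbb R^m$, $f:\Omega\times\{1,\dots,T\}\times\mathbb R^m\times\mathbb R^n\times\mathbb R^n\to\mathbb R^n$ and $h:\Omega\times\mathbb R^m\to\mathbb R^n$, and consider $$\begin{cases}\Delta X_t=b(t,X_t,Y_t,Z_t)+\sigma(t,X_t,Y_t,Z_t)\,\Delta W_t,\\ \Delta Y_t=-f(t+1,X_{t+1},Y_{t+1},Z_{t+1})+Z_t\,\Delta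 W_t+\Delta N_t,\\ X_0=x_0,\qquad Y_T=h(X_T),\end{cases}\qquad 0\le t\le T-1.\tag{1}$$ A *solution* is a quadruple $(X,Y,Z,N)\in\mathcal M^2(0,T;\mathbb R^m)\times\mathcal M^2(0,T;\mathbb R^n)\times\mathcal M^2(0,T-1;\mathbb R^n)\times\mathcal M^2(0,T;\mathbb R^n)$ satisfying (1) $P$-a.s., where $N$ is a martingale with $N_0=0$ that is strongly orthogonal to $W$ (each product $N^iW$ is a martingale). By (i) below $f(T,\cdot)$ does not depend on $z$, so no value $Z_T$ is needed. **Assumptions.** Let $G$ be an $n\times m$ real matrix of full rank $\min(m,n)$, with transpose $G^*$, and let $\beta_1,\beta_2\ge0$ with $\beta_1+\beta_2>0$, $\beta_1>0$ if $n>m$, and $\beta_2>0$ if $m>n$. Write $\lambda=(x,y,z)$ and $A(t,\lambda)=(-G^*f,\,Gb,\,G\sigma)(t,\lambda)$. (i) There is a constant $c>0$ such that, $P$-a.s., for all $\lambda=(x,y,z)$ and $\lambda'=(x',y',z')$: $b(t,\cdot)$ and $\sigma(t,\cdot)$ for $0\le t\le T-1$, and $f(t,\cdot)$ for $1\le t\le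 T-1$, satisfy $|\varphi(t,\lambda)-\varphi(t,\lambda')|\le c\,(|x-x'|+|y-y'|+|z-z'|)$; moreover $|f(T,\lambda)-f(T,\lambda')|\le c\,(|x-x'|+|y-y'|)$ and $|h(x)-h(x')|\le c\,|x-x'|$. (ii) For every fixed $\lambda$, the variables $b(t,\lambda),\sigma(t,\lambda)$ $(0\le t\le T-1)$ and $f(t,\lambda)$ $(1\le t\le T)$ are $\mathcal F_t$-measurable and square-integrable, and $h(x)$ is $\mathcal F_T$-measurable and square-integrable for every $x$. (iii) $P$-a.s., for all $\lambda,\lambda'$: - for $1\le t\le T-1$: $\langle A(t,\lambda)-A(t,\lambda'),\lambda-\lambda'\rangle\le-\beta_1|G(x-x')|^2-\beta_2|G^*(y-y')|^2-\beta_2|G^*(z-z')|^2$; - for $t=T$: $\langle-G^*f(T,\lambda)+G^*f(T,\lambda'),x-x'\rangle\le-\beta_1|G(x-x')|^2$; - for $t=0$: $\langle Gb(0,\lambda)-Gb(0,\lambda'),y-y'\rangle+\langle G\sigma(0,\lambda)-G\sigma(0,\lambda'),z-z'\rangle\le-\beta_2|G^*(y-y')|^2-\beta_2|G^*(z-z')|^2$;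 - $\langle h(x)-h(x'),G(x-x')\rangle\ge0$. **Theorem.** Under these assumptions, equation (1) has a solution $(X,Y,Z,N)$, and it is unique: any two solutions agree $P$-a.s. at every time. -/

import Mathlib

open MeasureTheory ProbabilityTheory

namespace FBSDelta

/-- `ℝ^k` with its Euclidean norm. -/
abbrev E (k : ℕ) : Type := EuclideanSpace ℝ (Fin k)

section Setup

variable {Ω : Type*} {mΩ : MeasurableSpace Ω}

/-- The standing assumptions on the filtered probability space and the driving noise.
Times `0, 1, …, T` are the elements of `Fin (T + 1)`; a step from `t` to `t + 1` is indexed by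
`t : Fin T` and goes from `t.castSucc` to `t.succ`.  `W` is a real square-integrable martingale
whose increments are independent of the past and have variance one, `ℱ` is the completion of the
filtration generated by `W`, `ℱ 0` is trivial and `ℱ T` is the whole `σ`-algebra. -/
structure IsDrivingNoise {T : ℕ} (P : Measure Ω) (ℱ : Filtration (Fin (T + 1)) mΩ)
    (W : Fin (T + 1) → Ω → ℝ) : Prop where
  /-- `ℱ t` is the `P`-completion of the `σ`-algebra generated by `W_s`, `s ≤ t`. -/
  completion : ∀ t, ℱ t = eventuallyMeasurableSpace
    (⨆ s : Fin (T + 1), ⨆ _ : s ≤ t, MeasurableSpace.comap (W s) inferInstance) (ae P)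
  /-- `ℱ 0` consists of `∅` and `Ω`, up to null sets. -/
  trivial_zero : ∀ s, MeasurableSet[ℱ 0] s → P s = 0 ∨ P s = 1
  full_last : ℱ (Fin.last T) = mΩ
  martingale : Martingale W ℱ P
  memLp : ∀ t, MemLp (W t) 2 P
  indep : ∀ t : Fin T,
    Indep (MeasurableSpace.comap (fun ω => W t.succ ω - W t.castSucc ω) inferInstance)
      (ℱ t.castSucc) P
  variance : ∀ t : Fin T, ∫ ω, (W t.succ ω - W t.castSucc ω) ^ 2 ∂P = 1

/-- The coefficients `b, σ` (times `0, …, T - 1`), `f` (times `1, …, T`; the value of `f` at time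
`0` does not enter the equation) and the terminal map `h`. -/
structure Coefficients (Ω : Type*) (T m n : ℕ) where
  b : Fin T → Ω → E m → E n → E n → E m
  σ : Fin T → Ω → E m → E n → E n → E m
  f : Fin (T + 1) → Ω → E m → E n → E n → E n
  h : Ω → E m → E n

/-- Lipschitz continuity, adaptedness and square integrability, and monotonicity of the
coefficients, with respect to the `n × m` matrix `G` and the constants `β₁, β₂`.

For `t ∈ {1, …, T - 1}` the left side of `monotone_mid` is
`⟨A(t,λ) - A(t,λ'), λ - λ'⟩` with `λ = (x, y, z)` and `A = (-Gᵀ f, G b, G σ)`. -/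
structure Assumptions {T m n : ℕ} (P : Measure Ω) (ℱ : Filtration (Fin (T + 1)) mΩ)
    (G : Matrix (Fin n) (Fin m) ℝ) (β₁ β₂ : ℝ) (C : Coefficients Ω T m n) : Prop where
  /-- All coefficients are Lipschitz with one deterministic constant, and `f` does not depend on
  `z` at time `T`. -/
  lipschitz : ∃ c : ℝ, 0 < c ∧
    (∀ t : Fin T, ∀ᵐ ω ∂P, ∀ (x x' : E m) (y y' z z' : E n),
      ‖C.b t ω x y z - C.b t ω x' y' z'‖ ≤ c * (‖x - x'‖ + ‖y - y'‖ + ‖z - z'‖)) ∧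
    (∀ t : Fin T, ∀ᵐ ω ∂P, ∀ (x x' : E m) (y y' z z' : E n),
      ‖C.σ t ω x y z - C.σ t ω x' y' z'‖ ≤ c * (‖x - x'‖ + ‖y - y'‖ + ‖z - z'‖)) ∧
    (∀ t : Fin T, 0 < (t : ℕ) → ∀ᵐ ω ∂P, ∀ (x x' : E m) (y y' z z' : E n),
      ‖C.f t.castSucc ω x y z - C.f t.castSucc ω x' y' z'‖
        ≤ c * (‖x - x'‖ + ‖y - y'‖ + ‖z - z'‖)) ∧
    (∀ᵐ ω ∂P, ∀ (x x' : E m) (y y' z z' : E n),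
      ‖C.f (Fin.last T) ω x y z - C.f (Fin.last T) ω x' y' z'‖
        ≤ c * (‖x - x'‖ + ‖y - y'‖)) ∧
    (∀ᵐ ω ∂P, ∀ x x' : E m, ‖C.h ω x - C.h ω x'‖ ≤ c * ‖x - x'‖)
  adapted_b : ∀ (t : Fin T) (x : E m) (y z : E n),
    StronglyMeasurable[ℱ t.castSucc] (fun ω => C.b t ω x y z) ∧
      MemLp (fun ω => C.b t ω x y z) 2 P
  adapted_σ : ∀ (t : Fin T) (x : E m) (y z : E n),
    StronglyMeasurable[ℱ t.castSucc] (fun ω => C.σ t ω x y z) ∧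
      MemLp (fun ω => C.σ t ω x y z) 2 P
  adapted_f : ∀ (t : Fin T) (x : E m) (y z : E n),
    StronglyMeasurable[ℱ t.succ] (fun ω => C.f t.succ ω x y z) ∧
      MemLp (fun ω => C.f t.succ ω x y z) 2 P
  adapted_h : ∀ x : E m,
    StronglyMeasurable[ℱ (Fin.last T)] (fun ω => C.h ω x) ∧ MemLp (fun ω => C.h ω x) 2 P
  /-- Monotonicity at the times `1, …, T - 1`. -/
  monotone_mid : ∀ t : Fin T, 0 < (t : ℕ) → ∀ᵐ ω ∂P, ∀ (x x' : E m) (y y' z z' : E n),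
    inner ℝ (-(G.transpose.toEuclideanLin (C.f t.castSucc ω x y z))
          + G.transpose.toEuclideanLin (C.f t.castSucc ω x' y' z')) (x - x')
        + inner ℝ (G.toEuclideanLin (C.b t ω x y z)
          - G.toEuclideanLin (C.b t ω x' y' z')) (y - y')
        + inner ℝ (G.toEuclideanLin (C.σ t ω x y z)
          - G.toEuclideanLin (C.σ t ω x' y' z')) (z - z')
      ≤ -β₁ * ‖G.toEuclideanLin (x - x')‖ ^ 2
        - β₂ * ‖G.transpose.toEuclideanLin (y - y')‖ ^ 2
        - β₂ * ‖G.transpose.toEuclideanLin (z - z')‖ ^ 2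
  /-- Monotonicity at time `T`. -/
  monotone_last : ∀ᵐ ω ∂P, ∀ (x x' : E m) (y y' z z' : E n),
    inner ℝ (-(G.transpose.toEuclideanLin (C.f (Fin.last T) ω x y z))
          + G.transpose.toEuclideanLin (C.f (Fin.last T) ω x' y' z')) (x - x')
      ≤ -β₁ * ‖G.toEuclideanLin (x - x')‖ ^ 2
  /-- Monotonicity at time `0`. -/
  monotone_zero : ∀ t : Fin T, (t : ℕ) = 0 → ∀ᵐ ω ∂P, ∀ (x x' : E m) (y y' z z' : E n),
    inner ℝ (G.toEuclideanLin (C.b t ω x y z)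
          - G.toEuclideanLin (C.b t ω x' y' z')) (y - y')
        + inner ℝ (G.toEuclideanLin (C.σ t ω x y z)
          - G.toEuclideanLin (C.σ t ω x' y' z')) (z - z')
      ≤ -β₂ * ‖G.transpose.toEuclideanLin (y - y')‖ ^ 2
        - β₂ * ‖G.transpose.toEuclideanLin (z - z')‖ ^ 2
  monotone_h : ∀ᵐ ω ∂P, ∀ x x' : E m,
    0 ≤ inner ℝ (C.h ω x - C.h ω x') (G.toEuclideanLin (x - x'))

/-- The extension by `0` to time `T` of a process indexed by `0, …, T - 1`.  It is only used as
the `z`-argument of `f` at time `T`, where `f` does not depend on `z`. -/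
def extendZ {T n : ℕ} (Z : Fin T → Ω → E n) (t : Fin (T + 1)) (ω : Ω) : E n :=
  if h : (t : ℕ) < T then Z ⟨t, h⟩ ω else 0

/-- `(X, Y, Z, N)` is an adapted square-integrable solution of the coupled forward-backward
stochastic difference equation
`ΔX_t = b(t, X_t, Y_t, Z_t) + σ(t, X_t, Y_t, Z_t) ΔW_t`,
`ΔY_t = -f(t+1, X_{t+1}, Y_{t+1}, Z_{t+1}) + Z_t ΔW_t + ΔN_t`, `X_0 = x₀`, `Y_T = h(X_T)`,
where `N` is a martingale with `N_0 = 0` which is strongly orthogonal to `W`, i.e. each product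
`N^i W` is a martingale. -/
structure IsSolution {T m n : ℕ} (P : Measure Ω) (ℱ : Filtration (Fin (T + 1)) mΩ)
    (W : Fin (T + 1) → Ω → ℝ) (C : Coefficients Ω T m n) (x₀ : E m)
    (X : Fin (T + 1) → Ω → E m) (Y : Fin (T + 1) → Ω → E n)
    (Z : Fin T → Ω → E n) (N : Fin (T + 1) → Ω → E n) : Prop where
  adapted_X : ∀ t, StronglyMeasurable[ℱ t] (X t) ∧ MemLp (X t) 2 P
  adapted_Y : ∀ t, StronglyMeasurable[ℱ t] (Y t) ∧ MemLp (Y t) 2 P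
  adapted_Z : ∀ t : Fin T, StronglyMeasurable[ℱ t.castSucc] (Z t) ∧ MemLp (Z t) 2 P
  adapted_N : ∀ t, StronglyMeasurable[ℱ t] (N t) ∧ MemLp (N t) 2 P
  forward : ∀ t : Fin T, ∀ᵐ ω ∂P,
    X t.succ ω - X t.castSucc ω
      = C.b t ω (X t.castSucc ω) (Y t.castSucc ω) (Z t ω)
        + (W t.succ ω - W t.castSucc ω) •
          C.σ t ω (X t.castSucc ω) (Y t.castSucc ω) (Z t ω)
  backward : ∀ t : Fin T, ∀ᵐ ω ∂P,
    Y t.succ ω - Y t.castSucc ω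
      = -C.f t.succ ω (X t.succ ω) (Y t.succ ω) (extendZ Z t.succ ω)
        + (W t.succ ω - W t.castSucc ω) • Z t ω
        + (N t.succ ω - N t.castSucc ω)
  initial : ∀ᵐ ω ∂P, X 0 ω = x₀
  terminal : ∀ᵐ ω ∂P, Y (Fin.last T) ω = C.h ω (X (Fin.last T) ω)
  martingale_N : Martingale N ℱ P
  orthogonal : ∀ i : Fin n, Martingale (fun t ω => N t ω i * W t ω) ℱ P
  initial_N : ∀ᵐ ω ∂P, N 0 ω = 0

end Setup

end FBSDelta

/-! Everything takes place in L²(P). With q = Y_{t+1} + f(t+1, ·), the backward equation reads q =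
Y_t + Z_t ΔW_t + ΔN_t. The increment ΔN_t has zero conditional mean and zero conditional covariance
with ΔW_t, and ΔW_t is centred with unit variance and independent of the past. So the equation
amounts to Y_t = E[q | ℱ_t] and Z_t = E[q ΔW_t | ℱ_t], with ΔN_t as the remainder. This eliminates N
and turns the problem into `residual u = w` for a map of the Banach space `Unknown` into itself. The
operators `condOp`, `noiseOp` and `noiseAdj` that enter it project on the past, so adaptedness is
not imposed on the unknowns: it follows from the equations.

Bijectivity of `residual` rests on `energy_identity`, obtained by telescoping ⟨G X_t, Y_t + f_t⟩ and
using that the forward operators are adjoint to the backward ones. Applied to a difference of two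
unknowns, monotonicity bounds one side below by β₁ Σ|G X|² + β₂ Σ(|G*Y|² + |G*Z|²), while the other
side is at most a constant times ‖u - u'‖ ‖residual u - residual u'‖. By the rank and sign
conditions, one of the two sums controls X, or else Y and Z before time T. The remaining components
follow by finitely many Lipschitz steps, forward or backward in time.

The resulting a priori estimate `norm_sub_le_residual` has a constant that depends on the
coefficients only through their Lipschitz and monotonicity constants. It gives injectivity at once.
It also holds uniformly along the segment from a decoupled linear system, which is solved
explicitly, so the method of continuation gives surjectivity (`residual_bijective`). Adapted
versions of the L² solution, together with the sums of the remainders, then solve the stochastic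
equation. -/

namespace FBSDelta

/-! ### The method of continuation in Banach spaces. -/

section Continuation

/-- One step of the method of continuation: a map which is expansive and onto stays onto under a
small Lipschitz perturbation. -/
theorem surjective_add_of_expansive {V : Type*} [NormedAddCommGroup V] [CompleteSpace V]
    {F R : V → V} {K δ : ℝ} (hK : 0 ≤ K) (hδ : 0 ≤ δ)
    (hF : ∀ u u', ‖u - u'‖ ≤ K * ‖F u - F u'‖) (hs : Function.Surjective F)
    (hR : ∀ u u', ‖R u - R u'‖ ≤ δ * ‖u - u'‖) (hKδ : K * δ < 1) :
    Function.Surjective (fun u => F u + R u) := by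
  intro w
  -- F u + R u = w means that u is a fixed point of `u ↦ I (w - R u)`, where the right inverse `I`
  -- of F is K-Lipschitz by expansiveness.
  choose I hI using hs
  have hlip : ContractingWith ⟨K * δ, by positivity⟩ (fun u => I (w - R u)) := by
    refine ⟨hKδ, LipschitzWith.of_dist_le_mul fun u u' => ?_⟩
    rw [dist_eq_norm, dist_eq_norm]
    calc ‖I (w - R u) - I (w - R u')‖ ≤ K * ‖F (I (w - R u)) - F (I (w - R u'))‖ := hF _ _
      _ = K * ‖R u - R u'‖ := by
        rw [hI, hI, sub_sub_sub_cancel_left, norm_sub_rev]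
      _ ≤ K * (δ * ‖u - u'‖) := by gcongr; exact hR _ _
      _ = K * δ * ‖u - u'‖ := by ring
  refine ⟨hlip.fixedPoint, ?_⟩
  have h : I (w - R hlip.fixedPoint) = hlip.fixedPoint := hlip.fixedPoint_isFixedPt
  have h2 := hI (w - R hlip.fixedPoint)
  rw [h] at h2
  simp only [h2, sub_add_cancel]

/-- The method of continuation along the segment from `L` to `S`. -/
theorem surjective_of_continuation {V : Type*} [NormedAddCommGroup V] [NormedSpace ℝ V]
    [CompleteSpace V] {L S : V → V} {K C : ℝ} (hK : 0 ≤ K) (hC : 0 ≤ C)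
    (hexp : ∀ a : ℝ, 0 ≤ a → a ≤ 1 → ∀ u u',
      ‖u - u'‖ ≤ K * ‖(L u + a • (S u - L u)) - (L u' + a • (S u' - L u'))‖)
    (hlip : ∀ u u', ‖(S u - L u) - (S u' - L u')‖ ≤ C * ‖u - u'‖)
    (hL : Function.Surjective L) : Function.Surjective S := by
  -- N equal steps, each a perturbation with Lipschitz constant C / N, so that K * (C / N) < 1. The
  -- uniformity of K in `a` keeps the step length fixed.
  obtain ⟨N, hN⟩ := exists_nat_gt (K * C)
  have hN0 : (0 : ℝ) < N := lt_of_le_of_lt (by positivity) hN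
  have key : ∀ k : ℕ, k ≤ N →
      Function.Surjective (fun u => L u + ((k : ℝ) / N) • (S u - L u)) := by
    intro k
    induction k with
    | zero => intro _; simpa using hL
    | succ k ih =>
      intro hk
      have hk' : (k : ℝ) ≤ N := by exact_mod_cast (Nat.le_of_succ_le hk)
      have := surjective_add_of_expansive (R := fun u => (1 / (N : ℝ)) • (S u - L u))
        (δ := C / N) hK (by positivity)
        (hexp (k / N) (by positivity) (by rw [div_le_one hN0]; exact hk'))
        (ih (Nat.le_of_succ_le hk)) (fun u u' => by
          rw [← smul_sub, norm_smul, Real.norm_of_nonneg (by positivity)]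
          calc 1 / (N : ℝ) * ‖S u - L u - (S u' - L u')‖
              ≤ 1 / (N : ℝ) * (C * ‖u - u'‖) := by gcongr; exact hlip u u'
            _ = C / N * ‖u - u'‖ := by ring)
        (by rw [← mul_div_assoc, div_lt_one hN0]; exact hN)
      convert this using 2 with u
      rw [add_assoc, ← add_smul]
      push_cast
      ring_nf
  have := key N le_rfl
  simpa [div_self hN0.ne'] using this

end Continuation

/-! ### Recursions on `Fin (T + 1)` and discrete Gronwall bounds. -/

section Recursion

theorem exists_forward_recursion {T : ℕ} {A : Type*} (x₀ : A) (g : Fin T → A → A) :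
    ∃ x : Fin (T + 1) → A, x 0 = x₀ ∧ ∀ t : Fin T, x t.succ = g t (x t.castSucc) :=
  ⟨fun s => Fin.induction (motive := fun _ => A) x₀ (fun t a => g t a) s, rfl, fun _ => rfl⟩

theorem exists_backward_recursion {T : ℕ} {A : Type*} (a : A) (g : Fin T → A → A) :
    ∃ x : Fin (T + 1) → A, x (Fin.last T) = a ∧
      ∀ t : Fin T, x t.castSucc = g t (x t.succ) :=
  ⟨fun s => Fin.reverseInduction (motive := fun _ => A) a (fun t a => g t a) s,
    Fin.reverseInduction_last, fun t => Fin.reverseInduction_castSucc t⟩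

/-- The induction shows `a s ≤ (1 + 2C)^s ε`. Since this power is at least 1, the source term ε is
dominated by the same quantity, whence the factor 2C. -/
theorem le_of_forward_recursion {T : ℕ} {a : Fin (T + 1) → ℝ} {C ε : ℝ} (hC : 0 ≤ C)
    (hε : 0 ≤ ε) (h0 : a 0 ≤ ε) (h : ∀ t : Fin T, a t.succ ≤ C * (a t.castSucc + ε)) (s) :
    a s ≤ (1 + 2 * C) ^ T * ε := by
  have hle : ∀ s : Fin (T + 1), a s ≤ (1 + 2 * C) ^ (s : ℕ) * ε := by
    intro s
    induction s using Fin.induction with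
    | zero => simpa using h0
    | succ t ih =>
      have h1 : 1 ≤ (1 + 2 * C) ^ (t : ℕ) := one_le_pow₀ (by linarith)
      rw [Fin.val_castSucc] at ih
      calc a t.succ ≤ C * (a t.castSucc + ε) := h t
        _ ≤ C * ((1 + 2 * C) ^ (t : ℕ) * ε + (1 + 2 * C) ^ (t : ℕ) * ε) := by
          gcongr
          exact le_mul_of_one_le_left hε h1
        _ ≤ (1 + 2 * C) ^ (t.succ : ℕ) * ε := by
          rw [Fin.val_succ, pow_succ]
          nlinarith [mul_nonneg (zero_le_one.trans h1) hε]
  refine (hle s).trans ?_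
  gcongr
  · linarith
  · omega

/-- Time reversal by `Fin.rev` reduces this to the forward bound. -/
theorem le_of_backward_recursion {T : ℕ} {a : Fin (T + 1) → ℝ} {C ε : ℝ} (hC : 0 ≤ C)
    (hε : 0 ≤ ε) (h0 : a (Fin.last T) ≤ ε)
    (h : ∀ t : Fin T, a t.castSucc ≤ C * (a t.succ + ε)) (s) :
    a s ≤ (1 + 2 * C) ^ T * ε := by
  have := le_of_forward_recursion (a := fun s => a s.rev) hC hε (by simpa using h0)
    (fun t => by simpa [Fin.rev_succ, Fin.rev_castSucc] using h t.rev) s.rev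
  simpa using this

end Recursion

/-! ### Abstract forward-backward systems and the energy identity. -/

section System

variable {T : ℕ} {H K : Type*} [NormedAddCommGroup H] [InnerProductSpace ℝ H]
  [NormedAddCommGroup K] [InnerProductSpace ℝ K]

/-- The linear data of a discrete forward-backward system in Hilbert spaces: a pairing operator
`G` with adjoint `G'`, and contractions which are adjoint to each other with respect to it. -/
structure LinearData (T : ℕ) (H K : Type*) [NormedAddCommGroup H] [InnerProductSpace ℝ H]
    [NormedAddCommGroup K] [InnerProductSpace ℝ K] where
  G : H →L[ℝ] K
  G' : K →L[ℝ] H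
  E : Fin T → H →L[ℝ] H
  M : Fin T → H →L[ℝ] H
  E' : Fin T → K →L[ℝ] K
  D : Fin T → K →L[ℝ] K
  inner_G : ∀ x y, inner ℝ (G x) y = inner ℝ x (G' y)
  inner_E : ∀ t x q, inner ℝ (G (E t x)) q = inner ℝ (G x) (E' t q)
  inner_M : ∀ t x q, inner ℝ (G (M t x)) q = inner ℝ (G x) (D t q)
  norm_E : ∀ t x, ‖E t x‖ ≤ ‖x‖
  norm_M : ∀ t x, ‖M t x‖ ≤ ‖x‖
  norm_E' : ∀ t x, ‖E' t x‖ ≤ ‖x‖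
  norm_D : ∀ t x, ‖D t x‖ ≤ ‖x‖

/-- Coefficients of a discrete forward-backward system in Hilbert spaces. -/
structure AbstractCoefficients (T : ℕ) (H K : Type*) where
  b : Fin T → H → K → K → H
  σ : Fin T → H → K → K → H
  f : Fin (T + 1) → H → K → K → K
  h : H → K

/-- Lipschitz continuity and monotonicity of the coefficients. -/
structure AbstractCoefficients.IsMonotone (D : LinearData T H K) (c β₁ β₂ : ℝ)
    (C : AbstractCoefficients T H K) : Prop where
  lip_b : ∀ t x x' y y' z z',
    ‖C.b t x y z - C.b t x' y' z'‖ ≤ c * (‖x - x'‖ + ‖y - y'‖ + ‖z - z'‖)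
  lip_σ : ∀ t x x' y y' z z',
    ‖C.σ t x y z - C.σ t x' y' z'‖ ≤ c * (‖x - x'‖ + ‖y - y'‖ + ‖z - z'‖)
  lip_f : ∀ t x x' y y' z z',
    ‖C.f t x y z - C.f t x' y' z'‖ ≤ c * (‖x - x'‖ + ‖y - y'‖ + ‖z - z'‖)
  lip_h : ∀ x x', ‖C.h x - C.h x'‖ ≤ c * ‖x - x'‖
  mono : ∀ (t : Fin T) x x' y y' z z',
    β₁ * ‖D.G (x - x')‖ ^ 2 + β₂ * (‖D.G' (y - y')‖ ^ 2 + ‖D.G' (z - z')‖ ^ 2) ≤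
      inner ℝ (D.G (x - x')) (C.f t.castSucc x y z - C.f t.castSucc x' y' z')
        - inner ℝ (D.G (C.b t x y z - C.b t x' y' z')) (y - y')
        - inner ℝ (D.G (C.σ t x y z - C.σ t x' y' z')) (z - z')
  mono_last : ∀ x x' y y' z z',
    β₁ * ‖D.G (x - x')‖ ^ 2 ≤
      inner ℝ (D.G (x - x')) (C.f (Fin.last T) x y z - C.f (Fin.last T) x' y' z')
  mono_h : ∀ x x', 0 ≤ inner ℝ (D.G (x - x')) (C.h x - C.h x')

/-- The unknowns `(X, Y, Z)` of the system. -/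
abbrev Unknown (T : ℕ) (H K : Type*) : Type _ :=
  (Fin (T + 1) → H) × (Fin (T + 1) → K) × (Fin (T + 1) → K)

/-- The defect of `(X, Y, Z)` in the equations of the system. -/
def residual (D : LinearData T H K) (C : AbstractCoefficients T H K) (u : Unknown T H K) :
    Unknown T H K :=
  (Fin.cons (α := fun _ => H) (u.1 0) fun t => u.1 t.succ
      - D.E t (u.1 t.castSucc + C.b t (u.1 t.castSucc) (u.2.1 t.castSucc) (u.2.2 t.castSucc))
      - D.M t (C.σ t (u.1 t.castSucc) (u.2.1 t.castSucc) (u.2.2 t.castSucc)),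
   Fin.snoc (α := fun _ => K) (fun t => u.2.1 t.castSucc
      - D.E' t (u.2.1 t.succ + C.f t.succ (u.1 t.succ) (u.2.1 t.succ) (u.2.2 t.succ)))
      (u.2.1 (Fin.last T) - C.h (u.1 (Fin.last T))),
   Fin.snoc (α := fun _ => K) (fun t => u.2.2 t.castSucc
      - D.D t (u.2.1 t.succ + C.f t.succ (u.1 t.succ) (u.2.1 t.succ) (u.2.2 t.succ)))
      (u.2.2 (Fin.last T)))

/-- The energy identity: summation by parts of the pairing `⟨G X, Y⟩`. -/
theorem energy_identity (D : LinearData T H K) {X : Fin (T + 1) → H} {Y Z f : Fin (T + 1) → K}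
    {b σ ρ : Fin T → H} {r s : Fin T → K}
    (hX : ∀ t, X t.succ = D.E t (X t.castSucc + b t) + D.M t (σ t) + ρ t)
    (hY : ∀ t, Y t.castSucc = D.E' t (Y t.succ + f t.succ) + r t)
    (hZ : ∀ t, Z t.castSucc = D.D t (Y t.succ + f t.succ) + s t) :
    inner ℝ (D.G (X (Fin.last T))) (Y (Fin.last T) + f (Fin.last T))
      + ∑ t : Fin T, (inner ℝ (D.G (X t.castSucc)) (f t.castSucc)
        - inner ℝ (D.G (b t)) (Y t.castSucc) - inner ℝ (D.G (σ t)) (Z t.castSucc))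
    = inner ℝ (D.G (X 0)) (Y 0 + f 0)
      + ∑ t : Fin T, (inner ℝ (D.G (ρ t)) (Y t.succ + f t.succ)
        - inner ℝ (D.G (X t.castSucc + b t)) (r t) - inner ℝ (D.G (σ t)) (s t)) := by
  -- Adjointness carries E and M over to E' and D acting on q = Y_{t+1} + f_{t+1}; these are Y_t and
  -- Z_t up to their defects.
  have step : ∀ t : Fin T, inner ℝ (D.G (X t.succ)) (Y t.succ + f t.succ)
      = inner ℝ (D.G (X t.castSucc + b t)) (Y t.castSucc - r t)
        + inner ℝ (D.G (σ t)) (Z t.castSucc - s t)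
        + inner ℝ (D.G (ρ t)) (Y t.succ + f t.succ) := by
    intro t
    have h1 : Y t.castSucc - r t = D.E' t (Y t.succ + f t.succ) := by rw [hY t]; abel
    have h2 : Z t.castSucc - s t = D.D t (Y t.succ + f t.succ) := by rw [hZ t]; abel
    rw [h1, h2, ← D.inner_E, ← D.inner_M, ← inner_add_left, ← inner_add_left, ← map_add,
      ← map_add, hX t]
  have tele : inner ℝ (D.G (X (Fin.last T))) (Y (Fin.last T) + f (Fin.last T))
      - inner ℝ (D.G (X 0)) (Y 0 + f 0)
      = ∑ t : Fin T, (inner ℝ (D.G (X t.succ)) (Y t.succ + f t.succ)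
        - inner ℝ (D.G (X t.castSucc)) (Y t.castSucc + f t.castSucc)) := by
    have e1 := Fin.sum_univ_succ
      (fun s : Fin (T + 1) => (inner ℝ (D.G (X s)) (Y s + f s) : ℝ))
    have e2 := Fin.sum_univ_castSucc
      (fun s : Fin (T + 1) => (inner ℝ (D.G (X s)) (Y s + f s) : ℝ))
    rw [Finset.sum_sub_distrib]
    linarith
  rw [← sub_eq_iff_eq_add', ← sub_eq_zero]
  have : ∀ t : Fin T, (inner ℝ (D.G (X t.succ)) (Y t.succ + f t.succ)
        - inner ℝ (D.G (X t.castSucc)) (Y t.castSucc + f t.castSucc) : ℝ)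
      = (inner ℝ (D.G (ρ t)) (Y t.succ + f t.succ)
        - inner ℝ (D.G (X t.castSucc + b t)) (r t) - inner ℝ (D.G (σ t)) (s t))
      - (inner ℝ (D.G (X t.castSucc)) (f t.castSucc)
        - inner ℝ (D.G (b t)) (Y t.castSucc) - inner ℝ (D.G (σ t)) (Z t.castSucc)) := by
    intro t
    rw [step t]
    simp only [map_add, inner_add_left, inner_add_right, inner_sub_right]
    ring
  rw [Finset.sum_congr rfl fun t _ => this t, Finset.sum_sub_distrib] at tele
  linarith

end System

/-! ### The energy estimate for differences of unknowns. -/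

section Estimate

variable {T : ℕ} {H K : Type*} [NormedAddCommGroup H] [NormedAddCommGroup K]

theorem Unknown.norm_fst_le (u : Unknown T H K) (s : Fin (T + 1)) : ‖u.1 s‖ ≤ ‖u‖ :=
  (norm_le_pi_norm _ s).trans (_root_.norm_fst_le u)

theorem Unknown.norm_snd_le (u : Unknown T H K) (s : Fin (T + 1)) : ‖u.2.1 s‖ ≤ ‖u‖ :=
  ((norm_le_pi_norm _ s).trans (_root_.norm_fst_le u.2)).trans (_root_.norm_snd_le u)

theorem Unknown.norm_trd_le (u : Unknown T H K) (s : Fin (T + 1)) : ‖u.2.2 s‖ ≤ ‖u‖ :=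
  ((norm_le_pi_norm _ s).trans (_root_.norm_snd_le u.2)).trans (_root_.norm_snd_le u)

theorem Unknown.norm_le {u : Unknown T H K} {r : ℝ} (hr : 0 ≤ r) (hX : ∀ s, ‖u.1 s‖ ≤ r)
    (hY : ∀ s, ‖u.2.1 s‖ ≤ r) (hZ : ∀ s, ‖u.2.2 s‖ ≤ r) : ‖u‖ ≤ r := by
  rw [Prod.norm_def, Prod.norm_def]
  exact max_le ((pi_norm_le_iff_of_nonneg hr).2 hX)
    (max_le ((pi_norm_le_iff_of_nonneg hr).2 hY) ((pi_norm_le_iff_of_nonneg hr).2 hZ))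

variable [InnerProductSpace ℝ H] [InnerProductSpace ℝ K]

theorem LinearData.abs_inner_le (D : LinearData T H K) {x : H} {y : K} {a b : ℝ}
    (hx : ‖x‖ ≤ a) (hy : ‖y‖ ≤ b) : |inner ℝ (D.G x) y| ≤ ‖D.G‖ * (a * b) := by
  have ha := (norm_nonneg x).trans hx
  calc |inner ℝ (D.G x) y| ≤ ‖D.G x‖ * ‖y‖ := abs_real_inner_le_norm _ _
    _ ≤ (‖D.G‖ * a) * b := by
      gcongr
      exact (D.G.le_opNorm x).trans (by gcongr)
    _ = _ := by ring

/-- The differences of two unknowns satisfy the difference of the equations, the defect being the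
difference of the residuals. -/
theorem residual_sub_equations (D : LinearData T H K) (C : AbstractCoefficients T H K)
    (u u' : Unknown T H K) :
    let d := u - u'
    let e := residual D C u - residual D C u'
    let b := fun t : Fin T => C.b t (u.1 t.castSucc) (u.2.1 t.castSucc) (u.2.2 t.castSucc)
      - C.b t (u'.1 t.castSucc) (u'.2.1 t.castSucc) (u'.2.2 t.castSucc)
    let σ := fun t : Fin T => C.σ t (u.1 t.castSucc) (u.2.1 t.castSucc) (u.2.2 t.castSucc)
      - C.σ t (u'.1 t.castSucc) (u'.2.1 t.castSucc) (u'.2.2 t.castSucc)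
    let f := fun s : Fin (T + 1) => C.f s (u.1 s) (u.2.1 s) (u.2.2 s)
      - C.f s (u'.1 s) (u'.2.1 s) (u'.2.2 s)
    d.1 0 = e.1 0 ∧
    (∀ t : Fin T, d.1 t.succ = D.E t (d.1 t.castSucc + b t) + D.M t (σ t) + e.1 t.succ) ∧
    (∀ t : Fin T, d.2.1 t.castSucc = D.E' t (d.2.1 t.succ + f t.succ) + e.2.1 t.castSucc) ∧
    (∀ t : Fin T, d.2.2 t.castSucc = D.D t (d.2.1 t.succ + f t.succ) + e.2.2 t.castSucc) ∧
    d.2.1 (Fin.last T) = C.h (u.1 (Fin.last T)) - C.h (u'.1 (Fin.last T)) + e.2.1 (Fin.last T) ∧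
    d.2.2 (Fin.last T) = e.2.2 (Fin.last T) := by
  refine ⟨?_, fun t => ?_, fun t => ?_, fun t => ?_, ?_, ?_⟩ <;>
    simp only [residual, Prod.fst_sub, Prod.snd_sub, Pi.sub_apply, Fin.cons_zero, Fin.cons_succ,
      Fin.snoc_last, Fin.snoc_castSucc, map_add, map_sub] <;> abel

/-- Every term on the right of the energy identity contains exactly one defect factor, of size δ
(the initial value `X 0` counts as a defect), so the bound is linear in δ. The other factor is of
order N. -/
theorem energy_le (D : LinearData T H K) {X : Fin (T + 1) → H} {Y Z f : Fin (T + 1) → K}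
    {b σ ρ : Fin T → H} {r s : Fin T → K}
    (hX : ∀ t, X t.succ = D.E t (X t.castSucc + b t) + D.M t (σ t) + ρ t)
    (hY : ∀ t, Y t.castSucc = D.E' t (Y t.succ + f t.succ) + r t)
    (hZ : ∀ t, Z t.castSucc = D.D t (Y t.succ + f t.succ) + s t)
    {c N δ : ℝ} (hN : 0 ≤ N) (hδ : 0 ≤ δ) (hXN : ∀ t, ‖X t‖ ≤ N)
    (hYN : ∀ t, ‖Y t‖ ≤ N) (hb : ∀ t, ‖b t‖ ≤ c * N) (hσ : ∀ t, ‖σ t‖ ≤ c * N)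
    (hf : ∀ t, ‖f t‖ ≤ c * N) (hX0 : ‖X 0‖ ≤ δ) (hρ : ∀ t, ‖ρ t‖ ≤ δ) (hr : ∀ t, ‖r t‖ ≤ δ)
    (hs : ∀ t, ‖s t‖ ≤ δ) :
    inner ℝ (D.G (X (Fin.last T))) (Y (Fin.last T) + f (Fin.last T))
      + ∑ t : Fin T, (inner ℝ (D.G (X t.castSucc)) (f t.castSucc)
        - inner ℝ (D.G (b t)) (Y t.castSucc) - inner ℝ (D.G (σ t)) (Z t.castSucc))
    ≤ (3 * T + 1) * (‖D.G‖ * (1 + c) * (N * δ)) := by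
  rw [energy_identity D hX hY hZ]
  -- A common bound for each of the 1 + 3T pairings on the right-hand side.
  set B := ‖D.G‖ * (1 + c) * (N * δ) with hB
  have hG := norm_nonneg D.G
  have b0 : inner ℝ (D.G (X 0)) (Y 0 + f 0) ≤ B :=
    (abs_le.1 ((D.abs_inner_le hX0 (norm_add_le_of_le (hYN 0) (hf 0))).trans_eq
      (by rw [hB]; ring))).2
  have b1 : ∀ t : Fin T, |inner ℝ (D.G (ρ t)) (Y t.succ + f t.succ)| ≤ B := fun t =>
    (D.abs_inner_le (hρ t) (norm_add_le_of_le (hYN _) (hf _))).trans_eq (by rw [hB]; ring)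
  have b2 : ∀ t : Fin T, |inner ℝ (D.G (X t.castSucc + b t)) (r t)| ≤ B := fun t =>
    (D.abs_inner_le (norm_add_le_of_le (hXN _) (hb t)) (hr t)).trans_eq (by rw [hB]; ring)
  have b3 : ∀ t : Fin T, |inner ℝ (D.G (σ t)) (s t)| ≤ B := fun t =>
    (D.abs_inner_le (hσ t) (hs t)).trans (by
      rw [hB, mul_assoc, mul_assoc]
      gcongr
      nlinarith [mul_nonneg hN hδ])
  have sum_le := Finset.sum_le_sum (s := Finset.univ) (g := fun _ => 3 * B)
    (f := fun t : Fin T => (inner ℝ (D.G (ρ t)) (Y t.succ + f t.succ)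
        - inner ℝ (D.G (X t.castSucc + b t)) (r t) - inner ℝ (D.G (σ t)) (s t) : ℝ)) fun t _ => by
      linarith [(abs_le.1 (b1 t)).2, (abs_le.1 (b2 t)).1, (abs_le.1 (b3 t)).1]
  simp only [Finset.sum_const, Finset.card_univ, Fintype.card_fin, nsmul_eq_mul] at sum_le
  linarith

/-- Monotonicity bounds the energy of the difference from below. At time T, Y equals the increment
of h plus a defect: the former pairs nonnegatively with G X, and the latter costs one more term,
whence 3T + 2. The constant 3c appears because each Lipschitz bound sums three norms, each at most
‖u - u'‖. -/
theorem energy_estimate (D : LinearData T H K) {c β₁ β₂ : ℝ} (hc : 0 ≤ c)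
    {C : AbstractCoefficients T H K} (hC : C.IsMonotone D c β₁ β₂) (u u' : Unknown T H K) :
    β₁ * ‖D.G ((u - u').1 (Fin.last T))‖ ^ 2
      + ∑ t : Fin T, (β₁ * ‖D.G ((u - u').1 t.castSucc)‖ ^ 2
        + β₂ * (‖D.G' ((u - u').2.1 t.castSucc)‖ ^ 2 + ‖D.G' ((u - u').2.2 t.castSucc)‖ ^ 2))
      ≤ (3 * T + 2) * (‖D.G‖ * (1 + 3 * c))
        * (‖u - u'‖ * ‖residual D C u - residual D C u'‖) := by
  obtain ⟨h0, hX, hY, hZ, hYT, -⟩ := residual_sub_equations D C u u'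
  set e := residual D C u - residual D C u'
  have lip : ∀ {s : Fin (T + 1)} {r : ℝ},
      r ≤ c * (‖(u - u').1 s‖ + ‖(u - u').2.1 s‖ + ‖(u - u').2.2 s‖) →
        r ≤ 3 * c * ‖u - u'‖ := by
    intro s r hr
    have h1 := (u - u').norm_fst_le s
    have h2 := (u - u').norm_snd_le s
    have h3 := (u - u').norm_trd_le s
    calc r ≤ c * (‖(u - u').1 s‖ + ‖(u - u').2.1 s‖ + ‖(u - u').2.2 s‖) := hr
      _ ≤ c * (‖u - u'‖ + ‖u - u'‖ + ‖u - u'‖) := by gcongr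
      _ = 3 * c * ‖u - u'‖ := by ring
  have hle := energy_le D (X := (u - u').1) (Y := (u - u').2.1) (Z := (u - u').2.2)
    (ρ := fun t => e.1 t.succ) (r := fun t => e.2.1 t.castSucc) (s := fun t => e.2.2 t.castSucc)
    (f := fun s => C.f s (u.1 s) (u.2.1 s) (u.2.2 s) - C.f s (u'.1 s) (u'.2.1 s) (u'.2.2 s))
    hX hY hZ (c := 3 * c) (norm_nonneg (u - u')) (norm_nonneg e)
    (u - u').norm_fst_le (u - u').norm_snd_le
    (fun t => lip (s := t.castSucc) (hC.lip_b t _ _ _ _ _ _))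
    (fun t => lip (s := t.castSucc) (hC.lip_σ t _ _ _ _ _ _))
    (fun s => lip (hC.lip_f s _ _ _ _ _ _)) (h0 ▸ e.norm_fst_le 0)
    (fun t => e.norm_fst_le _) (fun t => e.norm_snd_le _) (fun t => e.norm_trd_le _)
  have hmul : ‖D.G‖ * (‖u - u'‖ * ‖e‖) ≤ ‖D.G‖ * (1 + 3 * c) * (‖u - u'‖ * ‖e‖) :=
    mul_le_mul_of_nonneg_right (le_mul_of_one_le_right (norm_nonneg _) (by linarith))
      (by positivity)
  have bT := (abs_le.1 ((D.abs_inner_le ((u - u').norm_fst_le (Fin.last T))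
    (e.norm_snd_le (Fin.last T))).trans hmul)).1
  have sum_left := Finset.sum_le_sum fun (t : Fin T) (_ : t ∈ Finset.univ) =>
    hC.mono t (u.1 t.castSucc) (u'.1 t.castSucc) (u.2.1 t.castSucc) (u'.2.1 t.castSucc)
      (u.2.2 t.castSucc) (u'.2.2 t.castSucc)
  have hlast := hC.mono_last (u.1 (Fin.last T)) (u'.1 (Fin.last T)) (u.2.1 (Fin.last T))
    (u'.2.1 (Fin.last T)) (u.2.2 (Fin.last T)) (u'.2.2 (Fin.last T))
  have hh := hC.mono_h (u.1 (Fin.last T)) (u'.1 (Fin.last T))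
  rw [hYT] at hle
  simp only [inner_add_right] at hle
  simp only [Prod.fst_sub, Prod.snd_sub, Pi.sub_apply] at hle bT sum_left hlast hh ⊢
  linarith

end Estimate

/-- If the conclusion failed, then δ ≤ N, so δ² could be replaced by Nδ and a factor N cancelled. -/
theorem le_mul_of_sq_le {N δ a b : ℝ} (hN : 0 ≤ N) (hδ : 0 ≤ δ) (ha : 0 ≤ a) (hb : 0 ≤ b)
    (h : N ^ 2 ≤ a * (N * δ) + b * δ ^ 2) : N ≤ (a + b + 1) * δ := by
  by_contra! hlt
  have h1 : δ ≤ N := by nlinarith [mul_nonneg ha hδ, mul_nonneg hb hδ]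
  have hpos : 0 < N := by
    rcases hN.lt_or_eq with h | h
    · exact h
    · rw [← h] at hlt
      exact absurd hlt (not_lt.2 (by positivity))
  have h2 : b * δ ^ 2 ≤ b * (N * δ) := by
    rw [sq]; gcongr
  have h3 : N * N ≤ N * ((a + b) * δ) := by nlinarith
  have h4 := le_of_mul_le_mul_left h3 hpos
  linarith

/-! ### From the energy estimate to the a priori estimate. -/

section WellPosed

variable {T : ℕ} {H K : Type*} [NormedAddCommGroup H] [InnerProductSpace ℝ H]
  [NormedAddCommGroup K] [InnerProductSpace ℝ K]

/-- Once Y and Z are controlled before time T, the forward equation is explicit in X and the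
Lipschitz steps accumulate. The values of Y and Z at time T do not enter it. -/
theorem forward_bound (D : LinearData T H K) {c β₁ β₂ : ℝ} (hc : 0 ≤ c)
    {C : AbstractCoefficients T H K} (hC : C.IsMonotone D c β₁ β₂) (u u' : Unknown T H K) {ε : ℝ}
    (hY : ∀ t : Fin T, ‖(u - u').2.1 t.castSucc‖ ≤ ε)
    (hZ : ∀ t : Fin T, ‖(u - u').2.2 t.castSucc‖ ≤ ε)
    (hε : ‖residual D C u - residual D C u'‖ ≤ ε) (s) :
    ‖(u - u').1 s‖ ≤ (1 + 2 * (1 + 4 * c)) ^ T * ε := by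
  obtain ⟨h0, hX, -⟩ := residual_sub_equations D C u u'
  set e := residual D C u - residual D C u'
  refine le_of_forward_recursion (a := fun s => ‖(u - u').1 s‖) (by positivity)
    ((norm_nonneg _).trans hε) ((h0 ▸ e.norm_fst_le 0).trans hε) (fun t => ?_) s
  have hb := hC.lip_b t (u.1 t.castSucc) (u'.1 t.castSucc) (u.2.1 t.castSucc)
    (u'.2.1 t.castSucc) (u.2.2 t.castSucc) (u'.2.2 t.castSucc)
  have hσ := hC.lip_σ t (u.1 t.castSucc) (u'.1 t.castSucc) (u.2.1 t.castSucc)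
    (u'.2.1 t.castSucc) (u.2.2 t.castSucc) (u'.2.2 t.castSucc)
  have hl : c * (‖(u - u').1 t.castSucc‖ + ‖(u - u').2.1 t.castSucc‖
      + ‖(u - u').2.2 t.castSucc‖) ≤ c * (‖(u - u').1 t.castSucc‖ + ε + ε) := by
    gcongr
    exacts [hY t, hZ t]
  have key := hX t
  have := norm_add_le_of_le (norm_add_le_of_le
    ((D.norm_E t _).trans (norm_add_le_of_le (le_refl ‖(u - u').1 t.castSucc‖) (hb.trans hl)))
    ((D.norm_M t _).trans (hσ.trans hl))) ((e.norm_fst_le t.succ).trans hε)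
  dsimp only at key ⊢
  rw [key]
  refine this.trans ?_
  have := mul_nonneg hc (norm_nonneg ((u - u').1 t.castSucc))
  linarith

/-- Once X is controlled, the backward recursion closes on the sum of the norms of Y and Z, because
f involves both at the later time. -/
theorem backward_bound (D : LinearData T H K) {c β₁ β₂ : ℝ} (hc : 0 ≤ c)
    {C : AbstractCoefficients T H K} (hC : C.IsMonotone D c β₁ β₂) (u u' : Unknown T H K) {ε : ℝ}
    (hX : ∀ s, ‖(u - u').1 s‖ ≤ ε)
    (hε : ‖residual D C u - residual D C u'‖ ≤ ε) (s) :
    ‖(u - u').2.1 s‖ + ‖(u - u').2.2 s‖ ≤ (1 + 2 * (2 + 2 * c)) ^ T * ((2 + c) * ε) := by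
  obtain ⟨-, -, hY, hZ, hYT, hZT⟩ := residual_sub_equations D C u u'
  set e := residual D C u - residual D C u'
  have hε0 : 0 ≤ ε := (norm_nonneg _).trans hε
  refine le_of_backward_recursion (a := fun s => ‖(u - u').2.1 s‖ + ‖(u - u').2.2 s‖)
    (by positivity) (by positivity) ?_ (fun t => ?_) s
  · have h1 := norm_add_le_of_le ((hC.lip_h (u.1 (Fin.last T)) (u'.1 (Fin.last T))).trans
      (mul_le_mul_of_nonneg_left (hX (Fin.last T)) hc)) ((e.norm_snd_le (Fin.last T)).trans hε)
    have h2 := (e.norm_trd_le (Fin.last T)).trans hε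
    rw [hYT, hZT]
    linarith
  · have hf := (hC.lip_f t.succ (u.1 t.succ) (u'.1 t.succ) (u.2.1 t.succ)
      (u'.2.1 t.succ) (u.2.2 t.succ) (u'.2.2 t.succ))
    have hl : c * (‖(u - u').1 t.succ‖ + ‖(u - u').2.1 t.succ‖
        + ‖(u - u').2.2 t.succ‖) ≤ c * (ε + ‖(u - u').2.1 t.succ‖
        + ‖(u - u').2.2 t.succ‖) := by
      gcongr
      exact hX _
    have hq := norm_add_le_of_le (le_refl ‖(u - u').2.1 t.succ‖) (hf.trans hl)
    have h1 := norm_add_le_of_le ((D.norm_E' t _).trans hq)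
      ((e.norm_snd_le t.castSucc).trans hε)
    have h2 := norm_add_le_of_le ((D.norm_D t _).trans hq)
      ((e.norm_trd_le t.castSucc).trans hε)
    have k1 := hY t
    have k2 := hZ t
    dsimp only at k1 k2 ⊢
    rw [k1, k2]
    refine (add_le_add h1 h2).trans ?_
    nlinarith [norm_nonneg ((u - u').2.2 t.succ), mul_nonneg hc hε0,
      mul_nonneg hc (mul_nonneg hc hε0)]

/-- The nondegeneracy of the monotonicity: it controls either the forward or the backward
component of the unknown. -/
def LinearData.Coercive (D : LinearData T H K) (g β₁ β₂ : ℝ) : Prop :=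
  (0 < β₁ ∧ β₂ = 0 ∧ ∀ x, ‖x‖ ≤ g * ‖D.G x‖) ∨ (β₁ = 0 ∧ 0 < β₂ ∧ ∀ y, ‖y‖ ≤ g * ‖D.G' y‖)

theorem norm_sq_le_of_mul_sq_le {E F : Type*} [NormedAddCommGroup E] [NormedAddCommGroup F]
    {x : E} {y : F} {g β P : ℝ} (hβ : 0 < β) (hx : ‖x‖ ≤ g * ‖y‖)
    (h : β * ‖y‖ ^ 2 ≤ P) : ‖x‖ ^ 2 ≤ g ^ 2 / β * P := by
  calc ‖x‖ ^ 2 ≤ (g * ‖y‖) ^ 2 := by gcongr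
    _ = g ^ 2 / β * (β * ‖y‖ ^ 2) := by field_simp
    _ ≤ g ^ 2 / β * P := by gcongr

/-- The a priori estimate. -/
theorem norm_sub_le_residual (D : LinearData T H K) {c g β₁ β₂ : ℝ} (hc : 0 ≤ c)
    (hD : D.Coercive g β₁ β₂) :
    ∃ κ : ℝ, 0 ≤ κ ∧ ∀ C : AbstractCoefficients T H K, C.IsMonotone D c β₁ β₂ →
      ∀ u u', ‖u - u'‖ ≤ κ * ‖residual D C u - residual D C u'‖ := by
  set A := (3 * T + 2) * (‖D.G‖ * (1 + 3 * c)) with hA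
  have hA0 : 0 ≤ A := by positivity
  -- It is enough to bound ‖u - u'‖ linearly by the square root of B‖u - u'‖‖e‖ + ‖e‖², with e the
  -- difference of the residuals. The quadratic inequality so obtained is then solved for ‖u - u'‖.
  suffices h : ∃ R B : ℝ, 0 ≤ R ∧ 0 ≤ B ∧ ∀ C : AbstractCoefficients T H K,
      C.IsMonotone D c β₁ β₂ → ∀ u u', ∀ ε : ℝ, 0 ≤ ε →
        B * (‖u - u'‖ * ‖residual D C u - residual D C u'‖)
          + ‖residual D C u - residual D C u'‖ ^ 2 ≤ ε ^ 2 → ‖u - u'‖ ≤ R * ε by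
    obtain ⟨R, B, hR, hB, h⟩ := h
    refine ⟨R ^ 2 * B + R ^ 2 + 1, by positivity, fun C hC u u' => ?_⟩
    refine le_mul_of_sq_le (norm_nonneg _) (norm_nonneg _) (by positivity) (by positivity) ?_
    set r := B * (‖u - u'‖ * ‖residual D C u - residual D C u'‖)
      + ‖residual D C u - residual D C u'‖ ^ 2 with hr
    have hr0 : 0 ≤ r := by positivity
    have h1 := h C hC u u' (√r) (Real.sqrt_nonneg _) (Real.sq_sqrt hr0).ge
    calc ‖u - u'‖ ^ 2 ≤ (R * √r) ^ 2 := by gcongr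
      _ = R ^ 2 * r := by rw [mul_pow, Real.sq_sqrt hr0]
      _ = _ := by rw [hr]; ring
  rcases hD with ⟨hβ₁, hβ₂, hG⟩ | ⟨hβ₁, hβ₂, hG⟩
  · refine ⟨1 + (1 + 2 * (2 + 2 * c)) ^ T * (2 + c), g ^ 2 / β₁ * A, by positivity,
      by positivity, fun C hC u u' ε hε hle => ?_⟩
    have hen := energy_estimate D hc hC u u'
    rw [← hA] at hen
    set d := u - u'
    set e := residual D C u - residual D C u'
    have hsum : ∀ t : Fin T, 0 ≤ β₁ * ‖D.G (d.1 t.castSucc)‖ ^ 2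
        + β₂ * (‖D.G' (d.2.1 t.castSucc)‖ ^ 2 + ‖D.G' (d.2.2 t.castSucc)‖ ^ 2) := by
      intro t; rw [hβ₂]; positivity
    -- Here β₁ > 0: the energy controls G X, hence X, at every time including T.
    have hX : ∀ s, ‖d.1 s‖ ≤ ε := by
      intro s
      refine le_of_sq_le_sq ?_ hε
      have hs : β₁ * ‖D.G (d.1 s)‖ ^ 2 ≤ A * (‖d‖ * ‖e‖) := by
        induction s using Fin.lastCases with
        | last => exact (le_add_of_nonneg_right (Finset.sum_nonneg fun t _ => hsum t)).trans hen
        | cast t =>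
          have := Finset.single_le_sum (fun t _ => hsum t) (Finset.mem_univ t)
          rw [hβ₂, zero_mul, add_zero] at this
          refine (this.trans ?_).trans hen
          rw [hβ₂]
          exact le_add_of_nonneg_left (by positivity)
      have := norm_sq_le_of_mul_sq_le hβ₁ (hG _) hs
      rw [← mul_assoc] at this
      exact this.trans ((le_add_of_nonneg_right (by positivity)).trans hle)
    have heε : ‖e‖ ≤ ε := le_of_sq_le_sq
      ((le_add_of_nonneg_left (by positivity)).trans hle) hε
    have hYZ := backward_bound D hc hC u u' hX heε
    have hp : 0 ≤ (1 + 2 * (2 + 2 * c)) ^ T * ((2 + c) * ε) := by positivity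
    refine Unknown.norm_le (by positivity) (fun s => (hX s).trans ?_) (fun s => ?_) (fun s => ?_)
    · linarith
    · have h1 := hYZ s
      have h2 := norm_nonneg (d.2.2 s)
      linarith
    · have h1 := hYZ s
      have h2 := norm_nonneg (d.2.1 s)
      linarith
  · refine ⟨(1 + c) * (1 + (1 + 2 * (1 + 4 * c)) ^ T), g ^ 2 / β₂ * A, by positivity,
      by positivity, fun C hC u u' ε hε hle => ?_⟩
    have hen := energy_estimate D hc hC u u'
    rw [← hA] at hen
    obtain ⟨-, -, -, -, hYT, hZT⟩ := residual_sub_equations D C u u'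
    set d := u - u'
    set e := residual D C u - residual D C u'
    have hsum : ∀ t : Fin T, 0 ≤ β₁ * ‖D.G (d.1 t.castSucc)‖ ^ 2
        + β₂ * (‖D.G' (d.2.1 t.castSucc)‖ ^ 2 + ‖D.G' (d.2.2 t.castSucc)‖ ^ 2) := by
      intro t; rw [hβ₁]; positivity
    -- Here β₂ > 0: the energy controls Y and Z only before time T. Their terminal values are
    -- recovered last, from the terminal equations.
    have hs : ∀ t : Fin T, β₂ * (‖D.G' (d.2.1 t.castSucc)‖ ^ 2
        + ‖D.G' (d.2.2 t.castSucc)‖ ^ 2) ≤ A * (‖d‖ * ‖e‖) := by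
      intro t
      have := Finset.single_le_sum (fun t _ => hsum t) (Finset.mem_univ t)
      rw [hβ₁, zero_mul, zero_add] at this
      refine (this.trans ?_).trans hen
      rw [hβ₁]
      exact le_add_of_nonneg_left (by positivity)
    have conv : ∀ y : K, β₂ * ‖D.G' y‖ ^ 2 ≤ A * (‖d‖ * ‖e‖) → ‖y‖ ≤ ε := by
      intro y hy
      have := norm_sq_le_of_mul_sq_le hβ₂ (hG _) hy
      rw [← mul_assoc] at this
      exact le_of_sq_le_sq (this.trans ((le_add_of_nonneg_right (by positivity)).trans hle)) hε
    have hY : ∀ t : Fin T, ‖d.2.1 t.castSucc‖ ≤ ε := fun t => conv _ <| by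
      have := mul_nonneg hβ₂.le (sq_nonneg ‖D.G' (d.2.2 t.castSucc)‖)
      linarith [hs t]
    have hZ : ∀ t : Fin T, ‖d.2.2 t.castSucc‖ ≤ ε := fun t => conv _ <| by
      have := mul_nonneg hβ₂.le (sq_nonneg ‖D.G' (d.2.1 t.castSucc)‖)
      linarith [hs t]
    have heε : ‖e‖ ≤ ε := le_of_sq_le_sq
      ((le_add_of_nonneg_left (by positivity)).trans hle) hε
    have hX := forward_bound D hc hC u u' hY hZ heε
    set p := (1 + 2 * (1 + 4 * c)) ^ T
    have hp : 0 ≤ p * ε := by positivity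
    have hcp : 0 ≤ c * (p * ε) := by positivity
    have hcε : 0 ≤ c * ε := by positivity
    refine Unknown.norm_le (by positivity) (fun s => (hX s).trans ?_) (fun s => ?_) (fun s => ?_)
    · linarith
    · induction s using Fin.lastCases with
      | last =>
        have := norm_add_le_of_le ((hC.lip_h (u.1 (Fin.last T)) (u'.1 (Fin.last T))).trans
          (mul_le_mul_of_nonneg_left (hX (Fin.last T)) hc)) ((e.norm_snd_le (Fin.last T)).trans heε)
        rw [hYT]
        linarith
      | cast t => linarith [hY t]
    · induction s using Fin.lastCases with
      | last =>
        rw [hZT]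
        linarith [e.norm_trd_le (Fin.last T)]
      | cast t => linarith [hZ t]

end WellPosed

/-! ### Explicit solution of the base system, and continuation to the given one. -/

section Continuity

variable {T : ℕ} {H K : Type*} [NormedAddCommGroup H] [InnerProductSpace ℝ H]
  [NormedAddCommGroup K] [InnerProductSpace ℝ K]

theorem residual_eq_iff (D : LinearData T H K) (C : AbstractCoefficients T H K)
    (u w : Unknown T H K) : residual D C u = w ↔
      u.1 0 = w.1 0 ∧
      (∀ t : Fin T, u.1 t.succ
        = D.E t (u.1 t.castSucc + C.b t (u.1 t.castSucc) (u.2.1 t.castSucc) (u.2.2 t.castSucc))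
          + D.M t (C.σ t (u.1 t.castSucc) (u.2.1 t.castSucc) (u.2.2 t.castSucc))
          + w.1 t.succ) ∧
      (∀ t : Fin T, u.2.1 t.castSucc
        = D.E' t (u.2.1 t.succ + C.f t.succ (u.1 t.succ) (u.2.1 t.succ) (u.2.2 t.succ))
          + w.2.1 t.castSucc) ∧
      (∀ t : Fin T, u.2.2 t.castSucc
        = D.D t (u.2.1 t.succ + C.f t.succ (u.1 t.succ) (u.2.1 t.succ) (u.2.2 t.succ))
          + w.2.2 t.castSucc) ∧
      u.2.1 (Fin.last T) = C.h (u.1 (Fin.last T)) + w.2.1 (Fin.last T) ∧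
      u.2.2 (Fin.last T) = w.2.2 (Fin.last T) := by
  constructor
  · rintro rfl
    refine ⟨?_, fun t => ?_, fun t => ?_, fun t => ?_, ?_, ?_⟩ <;>
    simp only [residual, Fin.cons_zero, Fin.cons_succ, Fin.snoc_last, Fin.snoc_castSucc] <;> abel
  · rintro ⟨h0, hX, hY, hZ, hYT, hZT⟩
    refine Prod.ext ?_ (Prod.ext ?_ ?_)
    · funext s
      induction s using Fin.cases with
      | zero => simpa [residual] using h0
      | succ t =>
        simp only [residual, Fin.cons_succ]
        rw [hX t]
        abel
    · funext s
      induction s using Fin.lastCases with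
      | last => simp [residual, hYT]
      | cast t =>
        simp only [residual, Fin.snoc_castSucc]
        rw [hY t]
        abel
    · funext s
      induction s using Fin.lastCases with
      | last => simp [residual, hZT]
      | cast t =>
        simp only [residual, Fin.snoc_castSucc]
        rw [hZ t]
        abel

/-- For prescribed Y and Z the forward scheme is explicit. The next lemma is its counterpart
backward in time: Y and Z at time t are functions of the values at t + 1. -/
theorem exists_forward (D : LinearData T H K) (C : AbstractCoefficients T H K)
    (w : Fin (T + 1) → H) (Y Z : Fin (T + 1) → K) :
    ∃ X : Fin (T + 1) → H, X 0 = w 0 ∧ ∀ t : Fin T, X t.succ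
      = D.E t (X t.castSucc + C.b t (X t.castSucc) (Y t.castSucc) (Z t.castSucc))
        + D.M t (C.σ t (X t.castSucc) (Y t.castSucc) (Z t.castSucc)) + w t.succ :=
  exists_forward_recursion (w 0) fun t x =>
    D.E t (x + C.b t x (Y t.castSucc) (Z t.castSucc))
      + D.M t (C.σ t x (Y t.castSucc) (Z t.castSucc)) + w t.succ

theorem exists_backward (D : LinearData T H K) (C : AbstractCoefficients T H K)
    (w : (Fin (T + 1) → K) × (Fin (T + 1) → K)) (X : Fin (T + 1) → H) :
    ∃ Y Z : Fin (T + 1) → K,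
      (∀ t : Fin T, Y t.castSucc
        = D.E' t (Y t.succ + C.f t.succ (X t.succ) (Y t.succ) (Z t.succ)) + w.1 t.castSucc) ∧
      (∀ t : Fin T, Z t.castSucc
        = D.D t (Y t.succ + C.f t.succ (X t.succ) (Y t.succ) (Z t.succ)) + w.2 t.castSucc) ∧
      Y (Fin.last T) = C.h (X (Fin.last T)) + w.1 (Fin.last T) ∧
      Z (Fin.last T) = w.2 (Fin.last T) := by
  obtain ⟨V, hT, hV⟩ := exists_backward_recursion
    ((C.h (X (Fin.last T)) + w.1 (Fin.last T), w.2 (Fin.last T)) : K × K) fun t v =>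
      (D.E' t (v.1 + C.f t.succ (X t.succ) v.1 v.2) + w.1 t.castSucc,
        D.D t (v.1 + C.f t.succ (X t.succ) v.1 v.2) + w.2 t.castSucc)
  exact ⟨fun s => (V s).1, fun s => (V s).2, fun t => congrArg Prod.fst (hV t),
    fun t => congrArg Prod.snd (hV t), congrArg Prod.fst hT, congrArg Prod.snd hT⟩

/-- The linear coefficients from which the continuation starts. -/
def baseCoefficients (D : LinearData T H K) (β₁ β₂ : ℝ) : AbstractCoefficients T H K where
  b := fun _ _ y _ => -β₂ • D.G' y
  σ := fun _ _ _ z => -β₂ • D.G' z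
  f := fun _ x _ _ => β₁ • D.G x
  h := fun _ => 0

/-- When one of the constants vanishes the base system is triangular. If β₁ = 0 then f = 0 and h =
0, so (Y, Z) can be found first; if β₂ = 0 then b = σ = 0, so X can be found first. -/
theorem residual_baseCoefficients_surjective (D : LinearData T H K) {β₁ β₂ : ℝ}
    (hβ : β₁ = 0 ∨ β₂ = 0) : Function.Surjective (residual D (baseCoefficients D β₁ β₂)) := by
  intro w
  rcases hβ with rfl | rfl
  -- The zero process stands in for X, on which the backward equation does not depend here.
  · obtain ⟨Y, Z, hY, hZ, hYT, hZT⟩ := exists_backward D (baseCoefficients D 0 β₂) w.2 0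
    obtain ⟨X, h0, hX⟩ := exists_forward D (baseCoefficients D 0 β₂) w.1 Y Z
    refine ⟨(X, Y, Z), (residual_eq_iff D _ _ _).2
      ⟨h0, hX, fun t => (hY t).trans ?_, fun t => (hZ t).trans ?_, hYT, hZT⟩⟩ <;>
    simp [baseCoefficients]
  · obtain ⟨X, h0, hX⟩ := exists_forward D (baseCoefficients D β₁ 0) w.1 0 0
    obtain ⟨Y, Z, hY, hZ, hYT, hZT⟩ := exists_backward D (baseCoefficients D β₁ 0) w.2 X
    refine ⟨(X, Y, Z), (residual_eq_iff D _ _ _).2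
      ⟨h0, fun t => (hX t).trans ?_, hY, hZ, hYT, hZT⟩⟩
    simp [baseCoefficients]

/-- Serves to give both ends of the segment a common Lipschitz constant, and to replace one of β₁,
β₂ by 0. -/
theorem AbstractCoefficients.IsMonotone.weaken {D : LinearData T H K} {c c' β₁ β₂ β₁' β₂' : ℝ}
    {C : AbstractCoefficients T H K} (hC : C.IsMonotone D c β₁ β₂) (hc : c ≤ c')
    (h₁ : β₁' ≤ β₁) (h₂ : β₂' ≤ β₂) : C.IsMonotone D c' β₁' β₂' where
  lip_b t x x' y y' z z' := (hC.lip_b t x x' y y' z z').trans (by gcongr)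
  lip_σ t x x' y y' z z' := (hC.lip_σ t x x' y y' z z').trans (by gcongr)
  lip_f t x x' y y' z z' := (hC.lip_f t x x' y y' z z').trans (by gcongr)
  lip_h x x' := (hC.lip_h x x').trans (by gcongr)
  mono t x x' y y' z z' := le_trans (by gcongr) (hC.mono t x x' y y' z z')
  mono_last x x' y y' z z' := le_trans (by gcongr) (hC.mono_last x x' y y' z z')
  mono_h := hC.mono_h

/-- The base coefficients are chosen so that the monotonicity inequalities with β₁ and β₂ are
equalities. -/
theorem baseCoefficients_isMonotone (D : LinearData T H K) {β₁ β₂ : ℝ} (h₁ : 0 ≤ β₁)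
    (h₂ : 0 ≤ β₂) :
    (baseCoefficients D β₁ β₂).IsMonotone D (β₁ * ‖D.G‖ + β₂ * ‖D.G'‖) β₁ β₂ where
  lip_b t x x' y y' z z' := by
    simp only [baseCoefficients]
    rw [← smul_sub, ← map_sub, norm_smul, norm_neg, Real.norm_of_nonneg h₂]
    calc β₂ * ‖D.G' (y - y')‖ ≤ β₂ * (‖D.G'‖ * ‖y - y'‖) := by gcongr; exact D.G'.le_opNorm _
      _ = (0 + β₂ * ‖D.G'‖) * (0 + ‖y - y'‖ + 0) := by ring
      _ ≤ _ := by gcongr <;> positivity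
  lip_σ t x x' y y' z z' := by
    simp only [baseCoefficients]
    rw [← smul_sub, ← map_sub, norm_smul, norm_neg, Real.norm_of_nonneg h₂]
    calc β₂ * ‖D.G' (z - z')‖ ≤ β₂ * (‖D.G'‖ * ‖z - z'‖) := by gcongr; exact D.G'.le_opNorm _
      _ = (0 + β₂ * ‖D.G'‖) * (0 + 0 + ‖z - z'‖) := by ring
      _ ≤ _ := by gcongr <;> positivity
  lip_f t x x' y y' z z' := by
    simp only [baseCoefficients]
    rw [← smul_sub, ← map_sub, norm_smul, Real.norm_of_nonneg h₁]
    calc β₁ * ‖D.G (x - x')‖ ≤ β₁ * (‖D.G‖ * ‖x - x'‖) := by gcongr; exact D.G.le_opNorm _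
      _ = (β₁ * ‖D.G‖ + 0) * (‖x - x'‖ + 0 + 0) := by ring
      _ ≤ _ := by gcongr <;> positivity
  lip_h x x' := by
    simp only [baseCoefficients, sub_self, norm_zero]
    positivity
  mono t x x' y y' z z' := by
    simp only [baseCoefficients]
    rw [← smul_sub, ← smul_sub, ← smul_sub, ← map_sub, ← map_sub, ← map_sub, D.inner_G, D.inner_G]
    rw [map_smul, D.inner_G]
    simp only [inner_smul_left, inner_smul_right, real_inner_self_eq_norm_sq]
    rw [← D.inner_G, real_inner_self_eq_norm_sq]
    simp
    linarith
  mono_last x x' y y' z z' := by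
    simp only [baseCoefficients]
    rw [← smul_sub, ← map_sub, inner_smul_right, real_inner_self_eq_norm_sq]
  mono_h x x' := by simp [baseCoefficients]

/-- The segment between two systems of coefficients. -/
def AbstractCoefficients.segment (L C : AbstractCoefficients T H K) (a : ℝ) :
    AbstractCoefficients T H K where
  b := fun t x y z => (1 - a) • L.b t x y z + a • C.b t x y z
  σ := fun t x y z => (1 - a) • L.σ t x y z + a • C.σ t x y z
  f := fun t x y z => (1 - a) • L.f t x y z + a • C.f t x y z
  h := fun x => (1 - a) • L.h x + a • C.h x

theorem norm_segment_sub_le {E : Type*} [NormedAddCommGroup E] [NormedSpace ℝ E] {a r : ℝ}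
    (h0 : 0 ≤ a) (h1 : a ≤ 1) {p p' q q' : E} (hp : ‖p - p'‖ ≤ r) (hq : ‖q - q'‖ ≤ r) :
    ‖((1 - a) • p + a • q) - ((1 - a) • p' + a • q')‖ ≤ r := by
  have h : ((1 - a) • p + a • q) - ((1 - a) • p' + a • q')
      = (1 - a) • (p - p') + a • (q - q') := by module
  rw [h]
  have := (convex_closedBall (0 : E) r) (mem_closedBall_zero_iff.2 hp)
    (mem_closedBall_zero_iff.2 hq) (sub_nonneg.2 h1) h0 (by ring)
  exact mem_closedBall_zero_iff.1 this

theorem segment_sub_segment {E : Type*} [AddCommGroup E] [Module ℝ E] (a : ℝ) (p p' q q' : E) :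
    ((1 - a) • p + a • q) - ((1 - a) • p' + a • q') = (1 - a) • (p - p') + a • (q - q') := by
  module

theorem AbstractCoefficients.IsMonotone.segment {D : LinearData T H K} {c β₁ β₂ a : ℝ}
    {L C : AbstractCoefficients T H K} (hL : L.IsMonotone D c β₁ β₂) (hC : C.IsMonotone D c β₁ β₂)
    (h0 : 0 ≤ a) (h1 : a ≤ 1) : (L.segment C a).IsMonotone D c β₁ β₂ where
  lip_b t x x' y y' z z' :=
    norm_segment_sub_le h0 h1 (hL.lip_b t x x' y y' z z') (hC.lip_b t x x' y y' z z')
  lip_σ t x x' y y' z z' :=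
    norm_segment_sub_le h0 h1 (hL.lip_σ t x x' y y' z z') (hC.lip_σ t x x' y y' z z')
  lip_f t x x' y y' z z' :=
    norm_segment_sub_le h0 h1 (hL.lip_f t x x' y y' z z') (hC.lip_f t x x' y y' z z')
  lip_h x x' := norm_segment_sub_le h0 h1 (hL.lip_h x x') (hC.lip_h x x')
  mono t x x' y y' z z' := by
    have k1 := mul_le_mul_of_nonneg_left (hL.mono t x x' y y' z z') (sub_nonneg.2 h1)
    have k2 := mul_le_mul_of_nonneg_left (hC.mono t x x' y y' z z') h0
    simp only [AbstractCoefficients.segment, segment_sub_segment, map_add, map_smul,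
      inner_add_left, inner_add_right, real_inner_smul_left, real_inner_smul_right]
    linarith
  mono_last x x' y y' z z' := by
    have k1 := mul_le_mul_of_nonneg_left (hL.mono_last x x' y y' z z') (sub_nonneg.2 h1)
    have k2 := mul_le_mul_of_nonneg_left (hC.mono_last x x' y y' z z') h0
    simp only [AbstractCoefficients.segment, segment_sub_segment, inner_add_right,
      real_inner_smul_right]
    linarith
  mono_h x x' := by
    have k1 := mul_nonneg (sub_nonneg.2 h1) (hL.mono_h x x')
    have k2 := mul_nonneg h0 (hC.mono_h x x')
    simp only [AbstractCoefficients.segment, segment_sub_segment, inner_add_right,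
      real_inner_smul_right]
    linarith

/-- The residual is affine in the coefficients, so a segment of coefficients gives a segment of
residual maps. -/
theorem residual_segment (D : LinearData T H K) (L C : AbstractCoefficients T H K) (a : ℝ)
    (u : Unknown T H K) :
    residual D (L.segment C a) u = residual D L u + a • (residual D C u - residual D L u) := by
  rw [residual_eq_iff]
  refine ⟨?_, fun t => ?_, fun t => ?_, fun t => ?_, ?_, ?_⟩ <;>
  simp only [residual, AbstractCoefficients.segment, Prod.fst_add, Prod.snd_add, Prod.smul_fst,
    Prod.smul_snd, Prod.fst_sub, Prod.snd_sub, Pi.add_apply, Pi.smul_apply, Pi.sub_apply,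
    Fin.cons_zero, Fin.cons_succ, Fin.snoc_last, Fin.snoc_castSucc, map_add, map_smul] <;>
  module

theorem residual_lipschitz (D : LinearData T H K) {c β₁ β₂ : ℝ} (hc : 0 ≤ c)
    {C : AbstractCoefficients T H K} (hC : C.IsMonotone D c β₁ β₂) (u u' : Unknown T H K) :
    ‖residual D C u - residual D C u'‖ ≤ (2 + 6 * c) * ‖u - u'‖ := by
  obtain ⟨h0, hX, hY, hZ, hYT, hZT⟩ := residual_sub_equations D C u u'
  have lip : ∀ {s : Fin (T + 1)} {r : ℝ},
      r ≤ c * (‖(u - u').1 s‖ + ‖(u - u').2.1 s‖ + ‖(u - u').2.2 s‖) →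
        r ≤ 3 * c * ‖u - u'‖ := by
    intro s r hr
    have h1 := (u - u').norm_fst_le s
    have h2 := (u - u').norm_snd_le s
    have h3 := (u - u').norm_trd_le s
    calc r ≤ c * (‖(u - u').1 s‖ + ‖(u - u').2.1 s‖ + ‖(u - u').2.2 s‖) := hr
      _ ≤ c * (‖u - u'‖ + ‖u - u'‖ + ‖u - u'‖) := by gcongr
      _ = 3 * c * ‖u - u'‖ := by ring
  have hb : ∀ t : Fin T, _ := fun t => lip (s := t.castSucc) (hC.lip_b t _ _ _ _ _ _)
  have hσ : ∀ t : Fin T, _ := fun t => lip (s := t.castSucc) (hC.lip_σ t _ _ _ _ _ _)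
  have hf : ∀ s, _ := fun s => lip (s := s) (hC.lip_f s _ _ _ _ _ _)
  have hh := hC.lip_h (u.1 (Fin.last T)) (u'.1 (Fin.last T))
  have hh' : c * ‖(u - u').1 (Fin.last T)‖ ≤ c * ‖u - u'‖ := by
    gcongr
    exact (u - u').norm_fst_le _
  have hN : 0 ≤ ‖u - u'‖ := norm_nonneg _
  have hcN := mul_nonneg hc hN
  refine Unknown.norm_le (by positivity) (fun s => ?_) (fun s => ?_) (fun s => ?_)
  · induction s using Fin.cases with
    | zero =>
      rw [← h0]
      linarith [(u - u').norm_fst_le 0]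
    | succ t =>
      rw [← sub_eq_iff_eq_add'.2 (hX t)]
      have := norm_sub_le_of_le ((u - u').norm_fst_le t.succ) (norm_add_le_of_le
        ((D.norm_E t _).trans (norm_add_le_of_le ((u - u').norm_fst_le t.castSucc) (hb t)))
        ((D.norm_M t _).trans (hσ t)))
      linarith
  · induction s using Fin.lastCases with
    | last =>
      rw [← sub_eq_iff_eq_add'.2 hYT]
      have := norm_sub_le_of_le ((u - u').norm_snd_le (Fin.last T)) (hh.trans hh')
      linarith
    | cast t =>
      rw [← sub_eq_iff_eq_add'.2 (hY t)]
      have := norm_sub_le_of_le ((u - u').norm_snd_le t.castSucc)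
        ((D.norm_E' t _).trans (norm_add_le_of_le ((u - u').norm_snd_le t.succ) (hf t.succ)))
      linarith
  · induction s using Fin.lastCases with
    | last =>
      rw [← hZT]
      linarith [(u - u').norm_trd_le (Fin.last T)]
    | cast t =>
      rw [← sub_eq_iff_eq_add'.2 (hZ t)]
      have := norm_sub_le_of_le ((u - u').norm_trd_le t.castSucc)
        ((D.norm_D t _).trans (norm_add_le_of_le ((u - u').norm_snd_le t.succ) (hf t.succ)))
      linarith

/-- Well-posedness of monotone discrete forward-backward systems in Hilbert spaces. -/
theorem residual_bijective [CompleteSpace H] [CompleteSpace K] (D : LinearData T H K)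
    {c g β₁ β₂ : ℝ} (hc : 0 ≤ c) (hD : D.Coercive g β₁ β₂) {C : AbstractCoefficients T H K}
    (hC : C.IsMonotone D c β₁ β₂) : Function.Bijective (residual D C) := by
  obtain ⟨h₁, h₂, h₃⟩ : 0 ≤ β₁ ∧ 0 ≤ β₂ ∧ (β₁ = 0 ∨ β₂ = 0) := by
    rcases hD with ⟨h, h', -⟩ | ⟨h, h', -⟩
    · exact ⟨h.le, h'.ge, Or.inr h'⟩
    · exact ⟨h.ge, h'.le, Or.inl h⟩
  set c' := max c (β₁ * ‖D.G‖ + β₂ * ‖D.G'‖)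
  have hc' : 0 ≤ c' := hc.trans (le_max_left _ _)
  have hC' := hC.weaken (le_max_left c (β₁ * ‖D.G‖ + β₂ * ‖D.G'‖)) le_rfl le_rfl
  have hL := (baseCoefficients_isMonotone D h₁ h₂).weaken
    (le_max_right c (β₁ * ‖D.G‖ + β₂ * ‖D.G'‖)) le_rfl le_rfl
  obtain ⟨κ, hκ, hest⟩ := norm_sub_le_residual D hc' hD
  refine ⟨fun u u' h => ?_, ?_⟩
  · have := hest C hC' u u'
    rw [h, sub_self, norm_zero, mul_zero] at this
    exact sub_eq_zero.1 (norm_le_zero_iff.1 this)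
  · refine surjective_of_continuation (L := residual D (baseCoefficients D β₁ β₂)) hκ
      (C := 2 * (2 + 6 * c')) (by positivity) (fun a ha0 ha1 u u' => ?_) (fun u u' => ?_)
      (residual_baseCoefficients_surjective D h₃)
    · rw [← residual_segment, ← residual_segment]
      exact hest _ (hL.segment hC' ha0 ha1) u u'
    · rw [sub_sub_sub_comm]
      have := norm_sub_le_of_le (residual_lipschitz D hc' hC' u u')
        (residual_lipschitz D hc' hL u u')
      linarith

end Continuity

/-! ### Conditional expectation and multiplication by the noise as operators on L². -/

section Noise

set_option linter.unusedSectionVars false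

variable {Ω : Type*} {m mΩ : MeasurableSpace Ω} {P : Measure Ω}
  [IsProbabilityMeasure P] {ξ : Ω → ℝ}
  {V : Type*} [NormedAddCommGroup V] [InnerProductSpace ℝ V] [CompleteSpace V]
  {V' : Type*} [NormedAddCommGroup V'] [InnerProductSpace ℝ V'] [CompleteSpace V']

/-- A centred square-integrable random variable with unit variance, independent of `m`. -/
structure IsUnitNoise {Ω : Type*} (m : MeasurableSpace Ω) {mΩ : MeasurableSpace Ω} (P : Measure Ω)
    (ξ : Ω → ℝ) : Prop where
  le : m ≤ mΩ
  measurable : Measurable ξ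
  memLp : MemLp ξ 2 P
  integral_eq : ∫ ω, ξ ω ∂P = 0
  integral_sq : ∫ ω, ξ ω ^ 2 ∂P = 1
  indep : Indep (MeasurableSpace.comap ξ inferInstance) m P

theorem IsUnitNoise.lintegral_sq (hξ : IsUnitNoise m P ξ) : ∫⁻ ω, ‖ξ ω‖ₑ ^ (2 : ℝ) ∂P = 1 := by
  have h : ∀ ω, ‖ξ ω‖ₑ ^ (2 : ℝ) = ENNReal.ofReal (ξ ω ^ 2) := by
    intro ω
    rw [← ofReal_norm, ENNReal.ofReal_rpow_of_nonneg (norm_nonneg _) (by norm_num)]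
    simp
  simp_rw [h]
  rw [← ofReal_integral_eq_lintegral_ofReal hξ.memLp.integrable_sq
    (Filter.Eventually.of_forall fun ω => sq_nonneg _), hξ.integral_sq, ENNReal.ofReal_one]

/-- Multiplication by the noise preserves the `L²` seminorm of variables measurable with respect
to the past. -/
theorem IsUnitNoise.eLpNorm_smul (hξ : IsUnitNoise m P ξ) {x : Ω → V}
    (hx : AEStronglyMeasurable[m] x P) : eLpNorm (fun ω => ξ ω • x ω) 2 P = eLpNorm x 2 P := by
  have hae := hx.ae_eq_mk
  rw [eLpNorm_congr_ae hae, eLpNorm_congr_ae (g := fun ω => ξ ω • hx.mk x ω)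
    (by filter_upwards [hae] with ω h; rw [h])]
  rw [eLpNorm_eq_lintegral_rpow_enorm_toReal (by norm_num) (by norm_num),
    eLpNorm_eq_lintegral_rpow_enorm_toReal (by norm_num) (by norm_num)]
  congr 1
  simp only [ENNReal.toReal_ofNat, enorm_smul]
  simp_rw [ENNReal.mul_rpow_of_nonneg _ _ (zero_le_two (α := ℝ))]
  have hm1 : Measurable[MeasurableSpace.comap ξ inferInstance] (fun ω => ‖ξ ω‖ₑ ^ (2 : ℝ)) :=
    (measurable_enorm.pow_const _).comp (comap_measurable ξ)
  have hm2 : Measurable[m] (fun ω => ‖hx.mk x ω‖ₑ ^ (2 : ℝ)) :=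
    (hx.stronglyMeasurable_mk.enorm).pow_const _
  -- By independence the integral of |ξ|²|x|² factorises, and ξ has second moment 1.
  have := lintegral_mul_eq_lintegral_mul_lintegral_of_independent_measurableSpace
    hξ.measurable.comap_le hξ.le hξ.indep hm1 hm2
  rw [this, hξ.lintegral_sq, one_mul]

theorem IsUnitNoise.memLp_smul (hξ : IsUnitNoise m P ξ) {x : Ω → V}
    (hx : AEStronglyMeasurable[m] x P) (hx2 : MemLp x 2 P) :
    MemLp (fun ω => ξ ω • x ω) 2 P :=
  ⟨hξ.memLp.1.smul hx2.1, by rw [hξ.eLpNorm_smul hx]; exact hx2.2⟩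

theorem IsUnitNoise.integrable_smul (hξ : IsUnitNoise m P ξ) {x : Ω → V} (hx : MemLp x 2 P) :
    Integrable (fun ω => ξ ω • x ω) P :=
  memLp_one_iff_integrable.1 (hx.smul hξ.memLp)

theorem IsUnitNoise.condExp_eq (hξ : IsUnitNoise m P ξ) : P[ξ|m] =ᵐ[P] 0 := by
  have := condExp_indep_eq hξ.measurable.comap_le hξ.le
    (comap_measurable ξ).stronglyMeasurable hξ.indep
  rw [hξ.integral_eq] at this
  exact this

theorem IsUnitNoise.condExp_sq (hξ : IsUnitNoise m P ξ) :
    P[fun ω => ξ ω ^ 2|m] =ᵐ[P] fun _ => 1 := by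
  have := condExp_indep_eq (f := fun ω => ξ ω ^ 2) hξ.measurable.comap_le hξ.le
    ((comap_measurable ξ).pow_const 2).stronglyMeasurable hξ.indep
  rw [hξ.integral_sq] at this
  exact this

theorem IsUnitNoise.condExp_smul (hξ : IsUnitNoise m P ξ) {x : Ω → V}
    (hx : AEStronglyMeasurable[m] x P) (hx2 : MemLp x 2 P) :
    P[fun ω => ξ ω • x ω|m] =ᵐ[P] 0 := by
  have := condExp_smul_of_aestronglyMeasurable_right (hξ.memLp.integrable one_le_two)
    (hξ.integrable_smul hx2) hx
  refine this.trans ?_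
  filter_upwards [hξ.condExp_eq] with ω h
  simp [h]

theorem IsUnitNoise.condExp_smul_smul (hξ : IsUnitNoise m P ξ) {x : Ω → V}
    (hx : AEStronglyMeasurable[m] x P) (hx2 : MemLp x 2 P) :
    P[fun ω => ξ ω • ξ ω • x ω|m] =ᵐ[P] x := by
  have hint := hξ.integrable_smul (hξ.memLp_smul hx hx2)
  have heq : (fun ω => ξ ω • ξ ω • x ω) = (fun ω => ξ ω ^ 2) • x := by
    funext ω
    simp [smul_smul, sq]
  rw [heq] at hint ⊢
  refine (condExp_smul_of_aestronglyMeasurable_right hξ.memLp.integrable_sq hint hx).trans ?_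
  filter_upwards [hξ.condExp_sq] with ω h
  simp [h]

/-- Conditional expectation as an operator on `L²`. -/
noncomputable def condOp (P : Measure Ω) (V : Type*) [NormedAddCommGroup V]
    [InnerProductSpace ℝ V] [CompleteSpace V] (hm : m ≤ mΩ) : Lp V 2 P →L[ℝ] Lp V 2 P :=
  (lpMeas V ℝ m 2 P).subtypeL ∘L condExpL2 V ℝ hm

theorem condOp_ae_eq (hm : m ≤ mΩ) (x : Lp V 2 P) : condOp P V hm x =ᵐ[P] P[x|m] := by
  have := (Lp.memLp x).condExpL2_ae_eq_condExp (𝕜 := ℝ) hm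
  rwa [Lp.toLp_coeFn] at this

theorem aestronglyMeasurable_condOp (hm : m ≤ mΩ) (x : Lp V 2 P) :
    AEStronglyMeasurable[m] (condOp P V hm x) P :=
  aestronglyMeasurable_condExpL2 hm x

theorem norm_condOp_le (hm : m ≤ mΩ) (x : Lp V 2 P) : ‖condOp P V hm x‖ ≤ ‖x‖ :=
  norm_condExpL2_coe_le hm x

theorem inner_condOp (hm : m ≤ mΩ) (x y : Lp V 2 P) :
    inner ℝ (condOp P V hm x) y = inner ℝ x (condOp P V hm y) :=
  inner_condExpL2_left_eq_right hm

theorem condOp_of_aestronglyMeasurable (hm : m ≤ mΩ) {x : Lp V 2 P}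
    (hx : AEStronglyMeasurable[m] x P) : condOp P V hm x = x := by
  apply Lp.ext
  exact (condOp_ae_eq hm x).trans (condExp_of_aestronglyMeasurable' hm hx
    ((Lp.memLp x).integrable one_le_two))

/-- A deterministic linear map commutes with conditional expectation. With its analogue for
`noiseOp`, this makes the adjointness relations compatible with G. -/
theorem compLpL_condOp (hm : m ≤ mΩ) (L : V →L[ℝ] V') (x : Lp V 2 P) :
    L.compLpL 2 P (condOp P V hm x) = condOp P V' hm (L.compLpL 2 P x) := by
  apply Lp.ext
  refine (L.coeFn_compLpL _).trans ?_
  refine Filter.EventuallyEq.trans ?_ (condOp_ae_eq hm _).symm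
  refine Filter.EventuallyEq.trans ?_ (condExp_congr_ae (L.coeFn_compLpL x)).symm
  refine Filter.EventuallyEq.trans ?_
    (L.comp_condExp_comm ((Lp.memLp x).integrable one_le_two))
  filter_upwards [condOp_ae_eq hm x] with ω h
  simp [h]

/-- Multiplication by the noise, after projection on the past, as an operator on `L²`. -/
noncomputable def noiseOp (V : Type*) [NormedAddCommGroup V] [InnerProductSpace ℝ V]
    [CompleteSpace V] (hξ : IsUnitNoise m P ξ) : Lp V 2 P →L[ℝ] Lp V 2 P :=
  LinearMap.mkContinuous
    -- Projecting first makes the product square integrable for every x: independence of ξ applies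
    -- only to variables measurable with respect to the past.
    { toFun := fun x => (hξ.memLp_smul (aestronglyMeasurable_condOp hξ.le x)
        (Lp.memLp (condOp P V hξ.le x))).toLp
      map_add' := fun x y => by
        apply Lp.ext
        filter_upwards [MemLp.coeFn_toLp (hξ.memLp_smul
            (aestronglyMeasurable_condOp hξ.le (x + y)) (Lp.memLp (condOp P V hξ.le (x + y)))),
          MemLp.coeFn_toLp (hξ.memLp_smul (aestronglyMeasurable_condOp hξ.le x)
            (Lp.memLp (condOp P V hξ.le x))),
          MemLp.coeFn_toLp (hξ.memLp_smul (aestronglyMeasurable_condOp hξ.le y)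
            (Lp.memLp (condOp P V hξ.le y))),
          Lp.coeFn_add (hξ.memLp_smul (aestronglyMeasurable_condOp hξ.le x)
            (Lp.memLp (condOp P V hξ.le x))).toLp (hξ.memLp_smul
            (aestronglyMeasurable_condOp hξ.le y) (Lp.memLp (condOp P V hξ.le y))).toLp,
          Lp.coeFn_add (condOp P V hξ.le x) (condOp P V hξ.le y)] with ω h1 h2 h3 h4 h5
        rw [h1, h4, Pi.add_apply, h2, h3, map_add, h5, Pi.add_apply, smul_add]
      map_smul' := fun c x => by
        apply Lp.ext
        filter_upwards [MemLp.coeFn_toLp (hξ.memLp_smul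
            (aestronglyMeasurable_condOp hξ.le (c • x)) (Lp.memLp (condOp P V hξ.le (c • x)))),
          MemLp.coeFn_toLp (hξ.memLp_smul (aestronglyMeasurable_condOp hξ.le x)
            (Lp.memLp (condOp P V hξ.le x))),
          Lp.coeFn_smul c (hξ.memLp_smul (aestronglyMeasurable_condOp hξ.le x)
            (Lp.memLp (condOp P V hξ.le x))).toLp,
          Lp.coeFn_smul c (condOp P V hξ.le x)] with ω h1 h2 h3 h4
        rw [h1, RingHom.id_apply, h3, Pi.smul_apply, h2, map_smul, h4, Pi.smul_apply, smul_comm] }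
    1 (fun x => by
      rw [one_mul]
      change ‖(hξ.memLp_smul (aestronglyMeasurable_condOp hξ.le x)
        (Lp.memLp (condOp P V hξ.le x))).toLp‖ ≤ ‖x‖
      rw [Lp.norm_toLp, hξ.eLpNorm_smul (aestronglyMeasurable_condOp hξ.le x), ← Lp.norm_def]
      exact norm_condOp_le hξ.le x)

theorem noiseOp_ae_eq (hξ : IsUnitNoise m P ξ) (x : Lp V 2 P) :
    noiseOp V hξ x =ᵐ[P] fun ω => ξ ω • condOp P V hξ.le x ω :=
  MemLp.coeFn_toLp (hξ.memLp_smul (aestronglyMeasurable_condOp hξ.le x)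
    (Lp.memLp (condOp P V hξ.le x)))

theorem norm_noiseOp_le (hξ : IsUnitNoise m P ξ) (x : Lp V 2 P) : ‖noiseOp V hξ x‖ ≤ ‖x‖ := by
  have h : ‖noiseOp V hξ‖ ≤ 1 := LinearMap.mkContinuous_norm_le _ zero_le_one _
  exact ((noiseOp V hξ).le_opNorm x).trans (mul_le_of_le_one_left (norm_nonneg _) h)

theorem compLpL_noiseOp (hξ : IsUnitNoise m P ξ) (L : V →L[ℝ] V') (x : Lp V 2 P) :
    L.compLpL 2 P (noiseOp V hξ x) = noiseOp V' hξ (L.compLpL 2 P x) := by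
  apply Lp.ext
  have h0 := compLpL_condOp hξ.le L x
  filter_upwards [L.coeFn_compLpL (noiseOp V hξ x), noiseOp_ae_eq hξ x,
    noiseOp_ae_eq hξ (L.compLpL 2 P x), L.coeFn_compLpL (condOp P V hξ.le x)] with ω h1 h2 h3 h4
  rw [h1, h2, h3, ← h0, h4, map_smul]

/-- The adjoint of multiplication by the noise. -/
noncomputable def noiseAdj (V : Type*) [NormedAddCommGroup V] [InnerProductSpace ℝ V]
    [CompleteSpace V] (hξ : IsUnitNoise m P ξ) : Lp V 2 P →L[ℝ] Lp V 2 P :=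
  -- The adjoint is bounded on L² by construction, whereas `ξ • q` is a priori only integrable.
  ContinuousLinearMap.adjoint (noiseOp V hξ)

theorem norm_noiseAdj_le (hξ : IsUnitNoise m P ξ) (q : Lp V 2 P) :
    ‖noiseAdj V hξ q‖ ≤ ‖q‖ := by
  have h : ‖noiseAdj V hξ‖ ≤ 1 := by
    rw [noiseAdj, LinearIsometryEquiv.norm_map]
    exact LinearMap.mkContinuous_norm_le _ zero_le_one _
  exact ((noiseAdj V hξ).le_opNorm q).trans (mul_le_of_le_one_left (norm_nonneg _) h)

theorem inner_noiseOp (hξ : IsUnitNoise m P ξ) (x q : Lp V 2 P) :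
    inner ℝ (noiseOp V hξ x) q = inner ℝ x (noiseAdj V hξ q) :=
  (ContinuousLinearMap.adjoint_inner_right _ _ _).symm

/-- Dual to the fact that `noiseOp` is unchanged by a preliminary projection on the past. -/
theorem condOp_noiseAdj (hξ : IsUnitNoise m P ξ) (q : Lp V 2 P) :
    condOp P V hξ.le (noiseAdj V hξ q) = noiseAdj V hξ q := by
  refine ext_inner_left ℝ fun x => ?_
  rw [← inner_condOp, ← inner_noiseOp, ← inner_noiseOp]
  congr 1
  apply Lp.ext
  filter_upwards [noiseOp_ae_eq hξ x, noiseOp_ae_eq hξ (condOp P V hξ.le x)] with ω h1 h2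
  rw [h1, h2, condOp_of_aestronglyMeasurable hξ.le (aestronglyMeasurable_condOp hξ.le x)]

theorem aestronglyMeasurable_noiseAdj (hξ : IsUnitNoise m P ξ) (q : Lp V 2 P) :
    AEStronglyMeasurable[m] (noiseAdj V hξ q) P := by
  rw [← condOp_noiseAdj]
  exact aestronglyMeasurable_condOp hξ.le _

/-- The adjoint of multiplication by the noise is the conditional covariance with the noise. -/
theorem noiseAdj_ae_eq (hξ : IsUnitNoise m P ξ) (q : Lp V 2 P) :
    noiseAdj V hξ q =ᵐ[P] P[fun ω => ξ ω • q ω|m] := by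
  have hint := hξ.integrable_smul (Lp.memLp q)
  refine ae_eq_condExp_of_forall_setIntegral_eq hξ.le hint
    (fun s _ _ => ((Lp.memLp _).integrable one_le_two).integrableOn) (fun s hs hPs => ?_)
    (aestronglyMeasurable_noiseAdj hξ q)
  -- Pairing with the constant c turns the integral over s into an L² inner product with the
  -- indicator of s times c, which `condOp` fixes because s lies in `m`.
  refine ext_inner_left ℝ fun c => ?_
  rw [← L2.inner_indicatorConstLp_eq_inner_setIntegral ℝ (hξ.le s hs) hPs.ne, ← inner_noiseOp,
    L2.inner_def, ← integral_inner hint.integrableOn, ← integral_indicator (hξ.le s hs)]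
  have hind : condOp P V hξ.le (indicatorConstLp 2 (hξ.le s hs) hPs.ne c)
      = indicatorConstLp 2 (hξ.le s hs) hPs.ne c :=
    condExpL2_indicator_of_measurable hξ.le hs hPs.ne c
  refine integral_congr_ae ?_
  filter_upwards [noiseOp_ae_eq hξ (indicatorConstLp 2 (hξ.le s hs) hPs.ne c),
    indicatorConstLp_coeFn (p := 2) (hs := hξ.le s hs) (hμs := hPs.ne) (c := c)] with ω h1 h2
  rw [h1, hind, h2]
  by_cases hω : ω ∈ s
  · simp [hω, inner_smul_left, inner_smul_right]
  · simp [hω]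

end Noise

/-! ### Superposition operators of Lipschitz random fields. -/

section Superposition

set_option linter.unusedSectionVars false

variable {Ω : Type*} {m mΩ : MeasurableSpace Ω} {P : Measure Ω}
  {A B V : Type*}
  [NormedAddCommGroup A] [SecondCountableTopology A] [MeasurableSpace A] [BorelSpace A]
  [NormedAddCommGroup B] [SecondCountableTopology B] [MeasurableSpace B] [BorelSpace B]
  [NormedAddCommGroup V]

/-- A random field which is Lipschitz with a deterministic constant, measurable with respect to
`m` and square integrable. -/
structure IsLipschitzField (m : MeasurableSpace Ω) {mΩ : MeasurableSpace Ω} (P : Measure Ω)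
    (c : ℝ) (φ : Ω → A → B → B → V) : Prop where
  lip : ∀ᵐ ω ∂P, ∀ x x' y y' z z',
    ‖φ ω x y z - φ ω x' y' z'‖ ≤ c * (‖x - x'‖ + ‖y - y'‖ + ‖z - z'‖)
  meas : ∀ x y z, StronglyMeasurable[m] fun ω => φ ω x y z
  memLp : ∀ x y z, MemLp (fun ω => φ ω x y z) 2 P

/-- Carathéodory's theorem: a field continuous in its parameter and measurable in ω is jointly
measurable. -/
theorem stronglyMeasurable_apply_of_continuous {α ι β : Type*} {mα : MeasurableSpace α}
    [TopologicalSpace ι] [TopologicalSpace.MetrizableSpace ι] [MeasurableSpace ι]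
    [SecondCountableTopology ι] [OpensMeasurableSpace ι] [TopologicalSpace β]
    [TopologicalSpace.PseudoMetrizableSpace β] {φ : α → ι → β} (hc : ∀ a, Continuous (φ a))
    (hm : ∀ i, StronglyMeasurable fun a => φ a i) {X : α → ι} (hX : Measurable X) :
    StronglyMeasurable fun a => φ a (X a) :=
  (stronglyMeasurable_uncurry_of_continuous_of_stronglyMeasurable (u := fun i a => φ a i) hc
    hm).comp_measurable (hX.prodMk measurable_id)

theorem continuous_of_norm_sub_le {φ : A → B → B → V} {c : ℝ}
    (h : ∀ x x' y y' z z', ‖φ x y z - φ x' y' z'‖ ≤ c * (‖x - x'‖ + ‖y - y'‖ + ‖z - z'‖)) :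
    Continuous fun p : A × B × B => φ p.1 p.2.1 p.2.2 := by
  rw [continuous_iff_continuousAt]
  intro p
  rw [ContinuousAt, tendsto_iff_norm_sub_tendsto_zero]
  refine squeeze_zero (fun _ => norm_nonneg _) (fun q => h q.1 p.1 q.2.1 p.2.1 q.2.2 p.2.2) ?_
  have : Continuous fun q : A × B × B =>
      c * (‖q.1 - p.1‖ + ‖q.2.1 - p.2.1‖ + ‖q.2.2 - p.2.2‖) := by fun_prop
  simpa using this.tendsto p

theorem IsLipschitzField.aestronglyMeasurable {c : ℝ} {φ : Ω → A → B → B → V}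
    (hφ : IsLipschitzField m P c φ) (hnull : ∀ s, P s = 0 → MeasurableSet[m] s)
    {X : Ω → A} {Y Z : Ω → B} (hX : AEStronglyMeasurable[m] X P)
    (hY : AEStronglyMeasurable[m] Y P) (hZ : AEStronglyMeasurable[m] Z P) :
    AEStronglyMeasurable[m] (fun ω => φ ω (X ω) (Y ω) (Z ω)) P := by
  classical
  set S := {ω | ∀ x x' y y' z z',
    ‖φ ω x y z - φ ω x' y' z'‖ ≤ c * (‖x - x'‖ + ‖y - y'‖ + ‖z - z'‖)} with hS
  -- The Lipschitz condition ranges over uncountably many arguments; its validity set belongs to `m`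
  -- because the complement is null and `m` contains the null sets. Setting the field to 0 off this
  -- set makes it continuous for every ω.
  have hSm : MeasurableSet[m] S := by
    have : MeasurableSet[m] Sᶜ := hnull _ hφ.lip
    simpa using this.compl
  let ψ : Ω → A × B × B → V := fun ω p => if ω ∈ S then φ ω p.1 p.2.1 p.2.2 else 0
  have hψc : ∀ ω, Continuous (ψ ω) := by
    intro ω
    by_cases hω : ω ∈ S
    · simpa only [ψ, hω, if_true] using continuous_of_norm_sub_le hω
    · simpa only [ψ, hω, if_false] using continuous_const
  have hψm : ∀ p, StronglyMeasurable[m] fun ω => ψ ω p := fun p =>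
    StronglyMeasurable.ite hSm (hφ.meas p.1 p.2.1 p.2.2) stronglyMeasurable_const
  have hmeas : Measurable[m] fun ω => (hX.mk X ω, hY.mk Y ω, hZ.mk Z ω) :=
    hX.stronglyMeasurable_mk.measurable.prodMk
      (hY.stronglyMeasurable_mk.measurable.prodMk hZ.stronglyMeasurable_mk.measurable)
  refine ⟨fun ω => ψ ω (hX.mk X ω, hY.mk Y ω, hZ.mk Z ω),
    stronglyMeasurable_apply_of_continuous hψc hψm hmeas, ?_⟩
  filter_upwards [hX.ae_eq_mk, hY.ae_eq_mk, hZ.ae_eq_mk, hφ.lip] with ω h1 h2 h3 h4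
  have h5 : ω ∈ S := h4
  simp only [ψ, h5, if_true, ← h1, ← h2, ← h3]

theorem IsLipschitzField.memLp_apply {c : ℝ} {φ : Ω → A → B → B → V} (hm : m ≤ mΩ)
    (hφ : IsLipschitzField m P c φ) (hnull : ∀ s, P s = 0 → MeasurableSet s)
    {X : Ω → A} {Y Z : Ω → B} (hX : MemLp X 2 P) (hY : MemLp Y 2 P) (hZ : MemLp Z 2 P) :
    MemLp (fun ω => φ ω (X ω) (Y ω) (Z ω)) 2 P := by
  have hφ' : IsLipschitzField mΩ P c φ := ⟨hφ.lip, fun x y z => (hφ.meas x y z).mono hm, hφ.memLp⟩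
  refine MemLp.mono' ((hφ.memLp 0 0 0).norm.add (((hX.norm.add hY.norm).add hZ.norm).const_mul c))
    (hφ'.aestronglyMeasurable hnull hX.1 hY.1 hZ.1) ?_
  filter_upwards [hφ.lip] with ω h
  have := h (X ω) 0 (Y ω) 0 (Z ω) 0
  simp only [sub_zero] at this
  have h2 := norm_le_norm_add_norm_sub' (φ ω (X ω) (Y ω) (Z ω)) (φ ω 0 0 0)
  simp only [Pi.add_apply]
  linarith

open Classical in
/-- The superposition operator on `L²` of a random field. -/
noncomputable def superpose (P : Measure Ω) (φ : Ω → A → B → B → V) (X : Lp A 2 P)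
    (Y Z : Lp B 2 P) : Lp V 2 P :=
  if h : MemLp (fun ω => φ ω (X ω) (Y ω) (Z ω)) 2 P then h.toLp else 0

theorem IsLipschitzField.superpose_ae_eq {c : ℝ} {φ : Ω → A → B → B → V} (hm : m ≤ mΩ)
    (hφ : IsLipschitzField m P c φ) (hnull : ∀ s, P s = 0 → MeasurableSet s)
    (X : Lp A 2 P) (Y Z : Lp B 2 P) :
    superpose P φ X Y Z =ᵐ[P] fun ω => φ ω (X ω) (Y ω) (Z ω) := by
  rw [superpose, dif_pos (hφ.memLp_apply hm hnull (Lp.memLp X) (Lp.memLp Y) (Lp.memLp Z))]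
  exact MemLp.coeFn_toLp _

theorem norm_toLp_norm (u : Lp V 2 P) : ‖(Lp.memLp u).norm.toLp‖ = ‖u‖ := by
  rw [Lp.norm_toLp, eLpNorm_norm, Lp.norm_def]

/-- The pointwise norms are regarded as elements of L², where the triangle inequality applies to
their sum. -/
theorem norm_le_of_ae_norm_le {c : ℝ} {F : Lp V 2 P} {X : Lp A 2 P}
    {Y Z : Lp B 2 P} (hc : 0 ≤ c) (h : ∀ᵐ ω ∂P, ‖F ω‖ ≤ c * (‖X ω‖ + ‖Y ω‖ + ‖Z ω‖)) :
    ‖F‖ ≤ c * (‖X‖ + ‖Y‖ + ‖Z‖) := by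
  rw [← norm_toLp_norm X, ← norm_toLp_norm Y, ← norm_toLp_norm Z]
  refine (Lp.norm_le_mul_norm_of_ae_le_mul (g := (Lp.memLp X).norm.toLp + (Lp.memLp Y).norm.toLp
    + (Lp.memLp Z).norm.toLp) ?_).trans (mul_le_mul_of_nonneg_left (norm_add₃_le) hc)
  filter_upwards [h, Lp.coeFn_add ((Lp.memLp X).norm.toLp + (Lp.memLp Y).norm.toLp)
    (Lp.memLp Z).norm.toLp, Lp.coeFn_add (Lp.memLp X).norm.toLp (Lp.memLp Y).norm.toLp,
    (Lp.memLp X).norm.coeFn_toLp, (Lp.memLp Y).norm.coeFn_toLp,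
    (Lp.memLp Z).norm.coeFn_toLp] with ω h1 h2 h3 h4 h5 h6
  rw [h2, Pi.add_apply, h3, Pi.add_apply, h4, h5, h6, Real.norm_of_nonneg (by positivity)]
  exact h1

theorem IsLipschitzField.norm_superpose_sub_le {c : ℝ} {φ : Ω → A → B → B → V} (hm : m ≤ mΩ)
    (hφ : IsLipschitzField m P c φ) (hnull : ∀ s, P s = 0 → MeasurableSet s) (hc : 0 ≤ c)
    (X X' : Lp A 2 P) (Y Y' Z Z' : Lp B 2 P) :
    ‖superpose P φ X Y Z - superpose P φ X' Y' Z'‖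
      ≤ c * (‖X - X'‖ + ‖Y - Y'‖ + ‖Z - Z'‖) := by
  refine norm_le_of_ae_norm_le hc ?_
  filter_upwards [hφ.superpose_ae_eq hm hnull X Y Z, hφ.superpose_ae_eq hm hnull X' Y' Z',
    Lp.coeFn_sub (superpose P φ X Y Z) (superpose P φ X' Y' Z'), Lp.coeFn_sub X X',
    Lp.coeFn_sub Y Y', Lp.coeFn_sub Z Z', hφ.lip] with ω h1 h2 h3 h4 h5 h6 h7
  rw [h3, h4, h5, h6]
  simp only [Pi.sub_apply]
  rw [h1, h2]
  exact h7 _ _ _ _ _ _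

end Superposition

/-! ### Pointwise inequalities integrated to L². -/

section Energy

variable {Ω : Type*} {mΩ : MeasurableSpace Ω} {P : Measure Ω} {A B : Type*}
  [NormedAddCommGroup A] [InnerProductSpace ℝ A] [NormedAddCommGroup B] [InnerProductSpace ℝ B]

theorem compLpL_energy_le (L : A →L[ℝ] B) (L' : B →L[ℝ] A) {β₁ β₂ : ℝ} {x b σ : Lp A 2 P}
    {y z f : Lp B 2 P}
    (h : ∀ᵐ ω ∂P, β₁ * ‖L (x ω)‖ ^ 2 + β₂ * (‖L' (y ω)‖ ^ 2 + ‖L' (z ω)‖ ^ 2) ≤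
      inner ℝ (L (x ω)) (f ω) - inner ℝ (L (b ω)) (y ω) - inner ℝ (L (σ ω)) (z ω)) :
    β₁ * ‖L.compLpL 2 P x‖ ^ 2 + β₂ * (‖L'.compLpL 2 P y‖ ^ 2 + ‖L'.compLpL 2 P z‖ ^ 2) ≤
      inner ℝ (L.compLpL 2 P x) f - inner ℝ (L.compLpL 2 P b) y
        - inner ℝ (L.compLpL 2 P σ) z := by
  have hsub : Integrable (fun ω => (inner ℝ (L.compLpL 2 P x ω) (f ω)
      - inner ℝ (L.compLpL 2 P b ω) (y ω) : ℝ)) P :=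
    (L2.integrable_inner _ _).sub (L2.integrable_inner _ _)
  simp only [← real_inner_self_eq_norm_sq, L2.inner_def]
  rw [← integral_add (L2.integrable_inner _ _) (L2.integrable_inner _ _), ← integral_const_mul,
    ← integral_const_mul, ← integral_add ((L2.integrable_inner _ _).const_mul _)
      (((L2.integrable_inner _ _).add (L2.integrable_inner _ _)).const_mul _),
    ← integral_sub (L2.integrable_inner _ _) (L2.integrable_inner _ _),
    ← integral_sub hsub (L2.integrable_inner _ _)]
  refine integral_mono_ae (((L2.integrable_inner _ _).const_mul _).add
      (((L2.integrable_inner _ _).add (L2.integrable_inner _ _)).const_mul _))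
    (hsub.sub (L2.integrable_inner _ _)) ?_
  filter_upwards [h, L.coeFn_compLpL x, L.coeFn_compLpL b, L.coeFn_compLpL σ,
    L'.coeFn_compLpL y, L'.coeFn_compLpL z] with ω h0 h1 h2 h3 h4 h5
  simp only [h1, h2, h3, h4, h5, real_inner_self_eq_norm_sq]
  exact h0

theorem norm_le_compLpL {L : A →L[ℝ] B} {g : ℝ} (h : ∀ a, ‖a‖ ≤ g * ‖L a‖) (x : Lp A 2 P) :
    ‖x‖ ≤ g * ‖L.compLpL 2 P x‖ := by
  refine Lp.norm_le_mul_norm_of_ae_le_mul ?_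
  filter_upwards [L.coeFn_compLpL x] with ω h1
  rw [h1]
  exact h _

theorem inner_compLpL {L : A →L[ℝ] B} {L' : B →L[ℝ] A}
    (h : ∀ a b, inner ℝ (L a) b = inner ℝ a (L' b)) (x : Lp A 2 P) (y : Lp B 2 P) :
    inner ℝ (L.compLpL 2 P x) y = inner ℝ x (L'.compLpL 2 P y) := by
  rw [L2.inner_def, L2.inner_def]
  refine integral_congr_ae ?_
  filter_upwards [L.coeFn_compLpL x, L'.coeFn_compLpL y] with ω h1 h2
  rw [h1, h2, h]

end Energy

/-! ### The pairing matrix G and its lower bound under full column rank. -/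

section Matrix

/-- The continuous linear map between Euclidean spaces given by a matrix. -/
noncomputable def matrixCLM {n m : ℕ} (G : Matrix (Fin n) (Fin m) ℝ) : E m →L[ℝ] E n :=
  G.toEuclideanLin.toContinuousLinearMap

theorem matrixCLM_apply {n m : ℕ} (G : Matrix (Fin n) (Fin m) ℝ) (x : E m) :
    matrixCLM G x = G.toEuclideanLin x := rfl

theorem inner_matrixCLM {n m : ℕ} (G : Matrix (Fin n) (Fin m) ℝ) (x : E m) (y : E n) :
    inner ℝ (matrixCLM G x) y = inner ℝ x (matrixCLM G.transpose y) := by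
  rw [matrixCLM_apply, matrixCLM_apply, ← Matrix.conjTranspose_eq_transpose_of_trivial,
    Matrix.toEuclideanLin_conjTranspose_eq_adjoint, LinearMap.adjoint_inner_right]

/-- Full column rank means injectivity, and an injective linear map on a finite-dimensional space is
bounded below. -/
theorem exists_norm_le_matrixCLM {n m : ℕ} (G : Matrix (Fin n) (Fin m) ℝ) (hG : G.rank = m) :
    ∃ g : ℝ, ∀ x, ‖x‖ ≤ g * ‖matrixCLM G x‖ := by
  have hker : LinearMap.ker G.mulVecLin = ⊥ := by
    have := LinearMap.finrank_range_add_finrank_ker G.mulVecLin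
    rw [Matrix.rank] at hG
    rw [hG, Module.finrank_fin_fun] at this
    exact Submodule.finrank_eq_zero.1 (by omega)
  have hker' : LinearMap.ker (matrixCLM G).toLinearMap = ⊥ := by
    rw [LinearMap.ker_eq_bot']
    intro x hx
    have h1 : G.mulVecLin (WithLp.ofLp x) = 0 := congrArg WithLp.ofLp hx
    have h2 := (LinearMap.ker_eq_bot'.1 hker) _ h1
    exact (WithLp.ofLp_injective 2) h2
  obtain ⟨K, -, hK⟩ := (matrixCLM G).exists_antilipschitzWith hker'
  exact ⟨K, fun x => hK.le_mul_norm (map_zero _) x⟩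

end Matrix

/-! ### The stochastic system as an abstract system on L²(P). -/

section Concrete

set_option linter.unusedSectionVars false

variable {Ω : Type*} {mΩ : MeasurableSpace Ω} {P : Measure Ω} [IsProbabilityMeasure P]
  {T m n : ℕ} {ℱ : Filtration (Fin (T + 1)) mΩ} {W : Fin (T + 1) → Ω → ℝ}

theorem IsDrivingNoise.measurableSet_of_null (hW : IsDrivingNoise P ℱ W) (t : Fin (T + 1))
    (s : Set Ω) (hs : P s = 0) : MeasurableSet[ℱ t] s := by
  rw [hW.completion t]
  exact ⟨∅, MeasurableSpace.measurableSet_empty _, ae_eq_empty.2 hs⟩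

theorem IsDrivingNoise.measurableSet_of_null' (hW : IsDrivingNoise P ℱ W)
    (s : Set Ω) (hs : P s = 0) : MeasurableSet s :=
  ℱ.le 0 s (hW.measurableSet_of_null 0 s hs)

theorem IsDrivingNoise.isUnitNoise (hW : IsDrivingNoise P ℱ W) (t : Fin T) :
    IsUnitNoise (ℱ t.castSucc) P (fun ω => W t.succ ω - W t.castSucc ω) where
  le := ℱ.le _
  measurable := (((hW.martingale.stronglyMeasurable t.succ).mono (ℱ.le _)).measurable).sub
    (((hW.martingale.stronglyMeasurable t.castSucc).mono (ℱ.le _)).measurable)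
  memLp := (hW.memLp _).sub (hW.memLp _)
  integral_eq := by
    rw [integral_sub ((hW.memLp _).integrable one_le_two) ((hW.memLp _).integrable one_le_two),
      sub_eq_zero]
    have := hW.martingale.setIntegral_eq (Fin.castSucc_lt_succ (i := t)).le
      (MeasurableSet.univ (m := ℱ t.castSucc))
    simpa using this.symm
  integral_sq := hW.variance t
  indep := hW.indep t

/-- The linear data on `L²(P)`: conditional expectations, and multiplication by the increments of
the driving noise. -/
noncomputable def l2Data (hW : IsDrivingNoise P ℱ W) (G : Matrix (Fin n) (Fin m) ℝ) :
    LinearData T (Lp (E m) 2 P) (Lp (E n) 2 P) where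
  G := (matrixCLM G).compLpL 2 P
  G' := (matrixCLM G.transpose).compLpL 2 P
  E := fun t => condOp P (E m) (ℱ.le t.castSucc)
  M := fun t => noiseOp (E m) (hW.isUnitNoise t)
  E' := fun t => condOp P (E n) (ℱ.le t.castSucc)
  D := fun t => noiseAdj (E n) (hW.isUnitNoise t)
  inner_G := inner_compLpL (inner_matrixCLM G)
  inner_E := fun t x q => by rw [compLpL_condOp, inner_condOp]
  inner_M := fun t x q => by rw [compLpL_noiseOp, inner_noiseOp]
  norm_E := fun _ => norm_condOp_le _
  norm_M := fun _ => norm_noiseOp_le _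
  norm_E' := fun _ => norm_condOp_le _
  norm_D := fun _ => norm_noiseAdj_le _

/-- The superposition operators on `L²(P)` of the coefficients.  The value of `f` at time `0`,
which does not enter the equation, is chosen to be monotone. -/
noncomputable def l2Coefficients (P : Measure Ω) (G : Matrix (Fin n) (Fin m) ℝ) (β₁ : ℝ)
    (C : Coefficients Ω T m n) : AbstractCoefficients T (Lp (E m) 2 P) (Lp (E n) 2 P) where
  b := fun t => superpose P (C.b t)
  σ := fun t => superpose P (C.σ t)
  f := fun s => if s = 0 then fun X _ _ => β₁ • (matrixCLM G).compLpL 2 P X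
    else superpose P (C.f s)
  h := fun X => superpose (B := E n) P (fun ω x _ _ => C.h ω x) X 0 0

/-- The coefficients are Lipschitz fields. -/
structure Coefficients.IsLipschitz (P : Measure Ω) (ℱ : Filtration (Fin (T + 1)) mΩ) (c : ℝ)
    (C : Coefficients Ω T m n) : Prop where
  b : ∀ t : Fin T, IsLipschitzField (ℱ t.castSucc) P c (C.b t)
  σ : ∀ t : Fin T, IsLipschitzField (ℱ t.castSucc) P c (C.σ t)
  f : ∀ t : Fin T, IsLipschitzField (ℱ t.succ) P c (C.f t.succ)
  h : IsLipschitzField (B := E n) (ℱ (Fin.last T)) P c (fun ω x _ _ => C.h ω x)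

theorem Assumptions.exists_isLipschitz {G : Matrix (Fin n) (Fin m) ℝ} {β₁ β₂ : ℝ}
    {C : Coefficients Ω T m n} (hC : Assumptions P ℱ G β₁ β₂ C) :
    ∃ c, 0 < c ∧ C.IsLipschitz P ℱ c := by
  obtain ⟨c, hc, hb, hσ, hf, hfT, hh⟩ := hC.lipschitz
  refine ⟨c, hc, fun t => ⟨?_, fun x y z => (hC.adapted_b t x y z).1,
    fun x y z => (hC.adapted_b t x y z).2⟩, fun t => ⟨?_, fun x y z => (hC.adapted_σ t x y z).1,
    fun x y z => (hC.adapted_σ t x y z).2⟩, fun t => ⟨?_, fun x y z => (hC.adapted_f t x y z).1,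
    fun x y z => (hC.adapted_f t x y z).2⟩, ⟨?_, fun x _ _ => (hC.adapted_h x).1,
    fun x _ _ => (hC.adapted_h x).2⟩⟩
  · exact hb t
  · exact hσ t
  -- The Lipschitz hypothesis on f is given separately for interior times and for T, where the
  -- missing z-term only strengthens it.
  · rcases Fin.eq_castSucc_or_eq_last t.succ with ⟨t', h⟩ | h
    · have ht' : 0 < (t' : ℕ) := by
        have := congrArg Fin.val h
        simp only [Fin.val_succ, Fin.val_castSucc] at this
        omega
      rw [h]
      exact hf t' ht'
    · rw [h]
      filter_upwards [hfT] with ω hω x x' y y' z z'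
      refine (hω x x' y y' z z').trans (mul_le_mul_of_nonneg_left ?_ hc.le)
      linarith [norm_nonneg (z - z')]
  · filter_upwards [hh] with ω hω x x' y y' z z'
    refine (hω x x').trans (mul_le_mul_of_nonneg_left ?_ hc.le)
    linarith [norm_nonneg (y - y'), norm_nonneg (z - z')]

theorem l2Coefficients_f_zero (P : Measure Ω) (G : Matrix (Fin n) (Fin m) ℝ) (β₁ : ℝ)
    (C : Coefficients Ω T m n) (X : Lp (E m) 2 P) (Y Z : Lp (E n) 2 P) :
    (l2Coefficients P G β₁ C).f 0 X Y Z = β₁ • (matrixCLM G).compLpL 2 P X := by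
  simp [l2Coefficients]

theorem l2Coefficients_f_succ (P : Measure Ω) (G : Matrix (Fin n) (Fin m) ℝ) (β₁ : ℝ)
    (C : Coefficients Ω T m n) (t : Fin T) :
    (l2Coefficients P G β₁ C).f t.succ = superpose P (C.f t.succ) := by
  simp [l2Coefficients, Fin.succ_ne_zero]

theorem inner_neg_add_transpose (G : Matrix (Fin n) (Fin m) ℝ) (x : E m) (f f' : E n) :
    inner ℝ (-(G.transpose.toEuclideanLin f) + G.transpose.toEuclideanLin f') x
      = -inner ℝ (matrixCLM G x) (f - f') := by
  rw [inner_matrixCLM, map_sub, matrixCLM_apply, matrixCLM_apply, real_inner_comm,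
    ← inner_neg_right]
  congr 1
  abel

/-- Integration of the pointwise monotonicity. At time 0 the hypothesis has no term in x, and the
artificial value β₁ G X of f supplies exactly β₁|G X|². -/
theorem l2Coefficients_mono {G : Matrix (Fin n) (Fin m) ℝ} {β₁ β₂ c : ℝ}
    {C : Coefficients Ω T m n} (hW : IsDrivingNoise P ℱ W) (hC : Assumptions P ℱ G β₁ β₂ C)
    (hL : C.IsLipschitz P ℱ c) (t : Fin T) (X X' : Lp (E m) 2 P) (Y Y' Z Z' : Lp (E n) 2 P) :
    β₁ * ‖(matrixCLM G).compLpL 2 P (X - X')‖ ^ 2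
      + β₂ * (‖(matrixCLM G.transpose).compLpL 2 P (Y - Y')‖ ^ 2
        + ‖(matrixCLM G.transpose).compLpL 2 P (Z - Z')‖ ^ 2) ≤
      inner ℝ ((matrixCLM G).compLpL 2 P (X - X')) ((l2Coefficients P G β₁ C).f t.castSucc X Y Z
          - (l2Coefficients P G β₁ C).f t.castSucc X' Y' Z')
        - inner ℝ ((matrixCLM G).compLpL 2 P ((l2Coefficients P G β₁ C).b t X Y Z
          - (l2Coefficients P G β₁ C).b t X' Y' Z')) (Y - Y')
        - inner ℝ ((matrixCLM G).compLpL 2 P ((l2Coefficients P G β₁ C).σ t X Y Z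
          - (l2Coefficients P G β₁ C).σ t X' Y' Z')) (Z - Z') := by
  have hn := hW.measurableSet_of_null'
  apply compLpL_energy_le
  have hb := (hL.b t).superpose_ae_eq (ℱ.le _) hn
  have hσ := (hL.σ t).superpose_ae_eq (ℱ.le _) hn
  by_cases h0 : (t : ℕ) = 0
  · have ht : t.castSucc = 0 := Fin.ext h0
    rw [ht, l2Coefficients_f_zero, l2Coefficients_f_zero, ← smul_sub, ← map_sub]
    filter_upwards [hb X Y Z, hb X' Y' Z', hσ X Y Z, hσ X' Y' Z', Lp.coeFn_sub X X',
      Lp.coeFn_sub Y Y', Lp.coeFn_sub Z Z',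
      Lp.coeFn_sub (superpose P (C.b t) X Y Z) (superpose P (C.b t) X' Y' Z'),
      Lp.coeFn_sub (superpose P (C.σ t) X Y Z) (superpose P (C.σ t) X' Y' Z'),
      Lp.coeFn_smul β₁ ((matrixCLM G).compLpL 2 P (X - X')),
      (matrixCLM G).coeFn_compLpL (X - X'), hC.monotone_zero t h0]
      with ω h1 h2 h3 h4 h5 h6 h7 h8 h9 h10 h11 h12
    simp only [l2Coefficients]
    rw [h8, h9, h10, Pi.smul_apply, h11, h5, h6, h7]
    simp only [Pi.sub_apply]
    rw [h1, h2, h3, h4, inner_smul_right, real_inner_self_eq_norm_sq]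
    have := h12 (X ω) (X' ω) (Y ω) (Y' ω) (Z ω) (Z' ω)
    simp only [← map_sub, ← matrixCLM_apply] at this
    linarith
  · have ht : t.castSucc ≠ 0 := fun h => h0 (congrArg Fin.val h)
    have hf : ∀ X Y Z, superpose P (C.f t.castSucc) X Y Z
        =ᵐ[P] fun ω => C.f t.castSucc ω (X ω) (Y ω) (Z ω) := by
      obtain ⟨t', ht'⟩ := Fin.exists_succ_eq_of_ne_zero ht
      rw [← ht']
      exact (hL.f t').superpose_ae_eq (ℱ.le _) hn
    filter_upwards [hb X Y Z, hb X' Y' Z', hσ X Y Z, hσ X' Y' Z', hf X Y Z, hf X' Y' Z',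
      Lp.coeFn_sub X X', Lp.coeFn_sub Y Y', Lp.coeFn_sub Z Z',
      Lp.coeFn_sub (superpose P (C.b t) X Y Z) (superpose P (C.b t) X' Y' Z'),
      Lp.coeFn_sub (superpose P (C.σ t) X Y Z) (superpose P (C.σ t) X' Y' Z'),
      Lp.coeFn_sub (superpose P (C.f t.castSucc) X Y Z) (superpose P (C.f t.castSucc) X' Y' Z'),
      hC.monotone_mid t (Nat.pos_of_ne_zero h0)]
      with ω h1 h2 h3 h4 h1' h2' h5 h6 h7 h8 h9 h10 h12
    simp only [l2Coefficients, ht, if_false]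
    rw [h8, h9, h10, h5, h6, h7]
    simp only [Pi.sub_apply]
    rw [h1, h2, h3, h4, h1', h2']
    have := h12 (X ω) (X' ω) (Y ω) (Y' ω) (Z ω) (Z' ω)
    rw [inner_neg_add_transpose] at this
    simp only [← map_sub, ← matrixCLM_apply] at this
    linarith

theorem l2Coefficients_mono_last {G : Matrix (Fin n) (Fin m) ℝ} {β₁ β₂ c : ℝ}
    {C : Coefficients Ω T m n} (hW : IsDrivingNoise P ℱ W) (hC : Assumptions P ℱ G β₁ β₂ C)
    (hL : C.IsLipschitz P ℱ c) (X X' : Lp (E m) 2 P) (Y Y' Z Z' : Lp (E n) 2 P) :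
    β₁ * ‖(matrixCLM G).compLpL 2 P (X - X')‖ ^ 2 ≤
      inner ℝ ((matrixCLM G).compLpL 2 P (X - X'))
        ((l2Coefficients P G β₁ C).f (Fin.last T) X Y Z
          - (l2Coefficients P G β₁ C).f (Fin.last T) X' Y' Z') := by
  by_cases ht : Fin.last T = 0
  -- When T = 0 the last time is also time 0, where f has its artificial value.
  · rw [ht, l2Coefficients_f_zero, l2Coefficients_f_zero, ← smul_sub, ← map_sub, inner_smul_right,
      real_inner_self_eq_norm_sq]
  · have hf : ∀ X Y Z, superpose P (C.f (Fin.last T)) X Y Z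
        =ᵐ[P] fun ω => C.f (Fin.last T) ω (X ω) (Y ω) (Z ω) := by
      obtain ⟨t', ht'⟩ := Fin.exists_succ_eq_of_ne_zero ht
      rw [← ht']
      exact (hL.f t').superpose_ae_eq (ℱ.le _) hW.measurableSet_of_null'
    have := compLpL_energy_le (P := P) (matrixCLM G) (matrixCLM G.transpose) (β₁ := β₁) (β₂ := 0)
      (x := X - X') (b := 0) (σ := 0) (y := 0) (z := 0)
      (f := (l2Coefficients P G β₁ C).f (Fin.last T) X Y Z
          - (l2Coefficients P G β₁ C).f (Fin.last T) X' Y' Z') ?_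
    · simpa using this
    · filter_upwards [hf X Y Z, hf X' Y' Z', Lp.coeFn_sub X X',
        Lp.coeFn_sub (superpose P (C.f (Fin.last T)) X Y Z)
          (superpose P (C.f (Fin.last T)) X' Y' Z'), Lp.coeFn_zero (E m) 2 P, hC.monotone_last]
        with ω h1 h2 h3 h4 h5 h6
      simp only [l2Coefficients, ht, if_false]
      rw [h3, h4, h5]
      simp only [Pi.sub_apply, Pi.zero_apply, map_zero, inner_zero_left]
      rw [h1, h2]
      have := h6 (X ω) (X' ω) (Y ω) (Y' ω) (Z ω) (Z' ω)
      rw [inner_neg_add_transpose] at this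
      simp only [← matrixCLM_apply] at this
      linarith

theorem l2Coefficients_mono_h {G : Matrix (Fin n) (Fin m) ℝ} {β₁ β₂ c : ℝ}
    {C : Coefficients Ω T m n} (hW : IsDrivingNoise P ℱ W) (hC : Assumptions P ℱ G β₁ β₂ C)
    (hL : C.IsLipschitz P ℱ c) (X X' : Lp (E m) 2 P) :
    0 ≤ inner ℝ ((matrixCLM G).compLpL 2 P (X - X'))
      ((l2Coefficients P G β₁ C).h X - (l2Coefficients P G β₁ C).h X') := by
  have hh := hL.h.superpose_ae_eq (ℱ.le _) hW.measurableSet_of_null'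
  rw [L2.inner_def]
  refine integral_nonneg_of_ae ?_
  filter_upwards [hh X 0 0, hh X' 0 0, Lp.coeFn_sub X X',
    (matrixCLM G).coeFn_compLpL (X - X'),
    Lp.coeFn_sub ((l2Coefficients P G β₁ C).h X) ((l2Coefficients P G β₁ C).h X'),
    hC.monotone_h] with ω h1 h2 h3 h4 h5 h6
  rw [h5, h4, h3]
  simp only [l2Coefficients, Pi.sub_apply, Pi.zero_apply]
  rw [h1, h2, real_inner_comm]
  exact h6 _ _

theorem l2Coefficients_isMonotone {G : Matrix (Fin n) (Fin m) ℝ} {β₁ β₂ c : ℝ} (hβ₁ : 0 ≤ β₁)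
    (hc : 0 ≤ c) {C : Coefficients Ω T m n} (hW : IsDrivingNoise P ℱ W)
    (hC : Assumptions P ℱ G β₁ β₂ C) (hL : C.IsLipschitz P ℱ c) :
    (l2Coefficients P G β₁ C).IsMonotone (l2Data hW G)
      (c + β₁ * ‖(matrixCLM G).compLpL 2 P‖) β₁ β₂ := by
  have hn := hW.measurableSet_of_null'
  have hle : c ≤ c + β₁ * ‖(matrixCLM G).compLpL 2 P‖ := le_add_of_nonneg_right (by positivity)
  refine ⟨fun t X X' Y Y' Z Z' => ?_, fun t X X' Y Y' Z Z' => ?_, fun s X X' Y Y' Z Z' => ?_,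
    fun X X' => ?_, l2Coefficients_mono hW hC hL, l2Coefficients_mono_last hW hC hL,
    l2Coefficients_mono_h hW hC hL⟩
  · exact ((hL.b t).norm_superpose_sub_le (ℱ.le _) hn hc X X' Y Y' Z Z').trans (by gcongr)
  · exact ((hL.σ t).norm_superpose_sub_le (ℱ.le _) hn hc X X' Y Y' Z Z').trans (by gcongr)
  · induction s using Fin.cases with
    | zero =>
      rw [l2Coefficients_f_zero, l2Coefficients_f_zero, ← smul_sub, ← map_sub, norm_smul,
        Real.norm_of_nonneg hβ₁]
      calc β₁ * ‖(matrixCLM G).compLpL 2 P (X - X')‖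
          ≤ β₁ * (‖(matrixCLM G).compLpL 2 P‖ * ‖X - X'‖) := by
            gcongr
            exact ContinuousLinearMap.le_opNorm _ _
        _ = (0 + β₁ * ‖(matrixCLM G).compLpL 2 P‖) * (‖X - X'‖ + 0 + 0) := by ring
        _ ≤ _ := by gcongr <;> positivity
    | succ t =>
      rw [l2Coefficients_f_succ]
      exact ((hL.f t).norm_superpose_sub_le (ℱ.le _) hn hc X X' Y Y' Z Z').trans (by gcongr)
  · refine (hL.h.norm_superpose_sub_le (ℱ.le _) hn hc X X' 0 0 0 0).trans ?_
    simp only [sub_zero, norm_zero, add_zero]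
    gcongr

/-- Well-posedness of the system on `L²(P)`. -/
theorem l2_residual_bijective (hW : IsDrivingNoise P ℱ W) (G : Matrix (Fin n) (Fin m) ℝ)
    (hG : G.rank = min n m) {β₁ β₂ : ℝ} (hβ₁ : 0 ≤ β₁) (hβ₂ : 0 ≤ β₂) (hβ : 0 < β₁ + β₂)
    (hnm : m < n → 0 < β₁) (hmn : n < m → 0 < β₂) {C : Coefficients Ω T m n}
    (hC : Assumptions P ℱ G β₁ β₂ C) :
    Function.Bijective (residual (l2Data hW G) (l2Coefficients P G β₁ C)) := by
  obtain ⟨c, hc, hL⟩ := hC.exists_isLipschitz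
  have hmono := l2Coefficients_isMonotone hβ₁ hc.le hW hC hL
  have hc' : 0 ≤ c + β₁ * ‖(matrixCLM G).compLpL 2 P‖ := by positivity
  -- Select a positive constant whose matrix is injective: G for β₁, its transpose for β₂. In the
  -- square case both are injective and either constant will do. The other constant is then weakened
  -- to 0.
  have hcase : (m ≤ n ∧ 0 < β₁) ∨ (n ≤ m ∧ 0 < β₂) := by
    rcases lt_trichotomy m n with h | h | h
    · exact Or.inl ⟨h.le, hnm h⟩
    · rcases hβ₁.lt_or_eq with h' | h'
      · exact Or.inl ⟨h.le, h'⟩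
      · exact Or.inr ⟨h.ge, by linarith⟩
    · exact Or.inr ⟨h.le, hmn h⟩
  rcases hcase with ⟨h, hpos⟩ | ⟨h, hpos⟩
  · obtain ⟨g, hg⟩ := exists_norm_le_matrixCLM G (by rw [hG, min_eq_right h])
    exact residual_bijective (l2Data hW G) hc' (Or.inl ⟨hpos, rfl, norm_le_compLpL hg⟩)
      (hmono.weaken le_rfl le_rfl hβ₂)
  · obtain ⟨g, hg⟩ := exists_norm_le_matrixCLM G.transpose
      (by rw [Matrix.rank_transpose, hG, min_eq_left h])
    exact residual_bijective (l2Data hW G) hc' (Or.inr ⟨rfl, hpos, norm_le_compLpL hg⟩)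
      (hmono.weaken le_rfl hβ₁ le_rfl)

end Concrete

/-! ### One-step orthogonal decomposition and martingales strongly orthogonal to W. -/

section Orthogonality

set_option linter.unusedSectionVars false

variable {Ω : Type*} {m m' mΩ : MeasurableSpace Ω} {P : Measure Ω} [IsProbabilityMeasure P]
  {ξ : Ω → ℝ} {V : Type*} [NormedAddCommGroup V] [InnerProductSpace ℝ V] [CompleteSpace V]

theorem noiseOp_ae_eq_of_aestronglyMeasurable (hξ : IsUnitNoise m P ξ) {x : Lp V 2 P}
    (hx : AEStronglyMeasurable[m] x P) : noiseOp V hξ x =ᵐ[P] fun ω => ξ ω • x ω := by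
  have := noiseOp_ae_eq hξ x
  rwa [condOp_of_aestronglyMeasurable hξ.le hx] at this

theorem aestronglyMeasurable_noiseOp (hξ : IsUnitNoise m P ξ) (hm : m ≤ m')
    (hξ' : StronglyMeasurable[m'] ξ) (x : Lp V 2 P) :
    AEStronglyMeasurable[m'] (noiseOp V hξ x) P :=
  (hξ'.aestronglyMeasurable.smul ((aestronglyMeasurable_condOp hξ.le x).mono hm)).congr
    (noiseOp_ae_eq hξ x).symm

theorem condOp_noiseOp (hξ : IsUnitNoise m P ξ) (x : Lp V 2 P) :
    condOp P V hξ.le (noiseOp V hξ x) = 0 := by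
  apply Lp.ext
  exact (((condOp_ae_eq hξ.le _).trans (condExp_congr_ae (noiseOp_ae_eq hξ x))).trans
    (hξ.condExp_smul (aestronglyMeasurable_condOp hξ.le x) (Lp.memLp _))).trans
    (Lp.coeFn_zero V 2 P).symm

theorem noiseAdj_of_aestronglyMeasurable (hξ : IsUnitNoise m P ξ) {x : Lp V 2 P}
    (hx : AEStronglyMeasurable[m] x P) : noiseAdj V hξ x = 0 := by
  apply Lp.ext
  exact ((noiseAdj_ae_eq hξ x).trans (hξ.condExp_smul hx (Lp.memLp _))).trans
    (Lp.coeFn_zero V 2 P).symm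

theorem noiseAdj_noiseOp (hξ : IsUnitNoise m P ξ) (x : Lp V 2 P) :
    noiseAdj V hξ (noiseOp V hξ x) = condOp P V hξ.le x := by
  apply Lp.ext
  refine (noiseAdj_ae_eq hξ _).trans ((condExp_congr_ae ?_).trans
    (hξ.condExp_smul_smul (aestronglyMeasurable_condOp hξ.le x) (Lp.memLp _)))
  filter_upwards [noiseOp_ae_eq hξ x] with ω h
  rw [h]

/-- A one-step martingale which is orthogonal to the noise. -/
structure IsOrthogonal (hξ : IsUnitNoise m P ξ) (d : Lp V 2 P) : Prop where
  condOp_eq_zero : condOp P V hξ.le d = 0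
  noiseAdj_eq_zero : noiseAdj V hξ d = 0

/-- Existence half of the one-step Galtchouk–Kunita–Watanabe decomposition;
`IsOrthogonal.eq_of_decomposition` is the uniqueness half. Both follow from E[ξ | m] = 0 and E[ξ² |
m] = 1. -/
theorem isOrthogonal_residual (hξ : IsUnitNoise m P ξ) (q : Lp V 2 P) :
    IsOrthogonal hξ (q - condOp P V hξ.le q - noiseOp V hξ (noiseAdj V hξ q)) := by
  constructor
  · rw [map_sub, map_sub, condOp_noiseOp,
      condOp_of_aestronglyMeasurable hξ.le (aestronglyMeasurable_condOp hξ.le q), sub_self, sub_zero]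
  · rw [map_sub, map_sub, noiseAdj_noiseOp, condOp_noiseAdj,
      noiseAdj_of_aestronglyMeasurable hξ (aestronglyMeasurable_condOp hξ.le q), sub_zero, sub_self]

theorem IsOrthogonal.eq_of_decomposition {hξ : IsUnitNoise m P ξ} {y z d : Lp V 2 P}
    (hd : IsOrthogonal hξ d) (hy : AEStronglyMeasurable[m] y P)
    (hz : AEStronglyMeasurable[m] z P) :
    condOp P V hξ.le (y + noiseOp V hξ z + d) = y ∧
      noiseAdj V hξ (y + noiseOp V hξ z + d) = z := by
  constructor
  · rw [map_add, map_add, condOp_noiseOp, hd.condOp_eq_zero,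
      condOp_of_aestronglyMeasurable hξ.le hy, add_zero, add_zero]
  · rw [map_add, map_add, noiseAdj_noiseOp, hd.noiseAdj_eq_zero,
      noiseAdj_of_aestronglyMeasurable hξ hy, condOp_of_aestronglyMeasurable hξ.le hz, add_zero,
      zero_add]

theorem integrable_smul_of_memLp_two {w : Ω → ℝ} {v : Ω → V} (hw : MemLp w 2 P)
    (hv : MemLp v 2 P) : Integrable (w • v) P :=
  memLp_one_iff_integrable.1 (hv.smul hw)

theorem IsOrthogonal.condExp_add_eq {hξ : IsUnitNoise m P ξ} {d : Lp V 2 P}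
    (hd : IsOrthogonal hξ d) {v : Ω → V} (hv : AEStronglyMeasurable[m] v P) (hv2 : MemLp v 2 P) :
    P[fun ω => v ω + d ω|m] =ᵐ[P] v := by
  have h1 := condExp_add (hv2.integrable one_le_two) ((Lp.memLp d).integrable one_le_two) m
  have h2 := condExp_of_aestronglyMeasurable' hξ.le hv (hv2.integrable one_le_two)
  have h3 := condOp_ae_eq hξ.le d
  rw [hd.condOp_eq_zero] at h3
  refine (show P[fun ω => v ω + d ω|m] =ᵐ[P] _ from h1).trans ?_
  filter_upwards [h2, h3, Lp.coeFn_zero V 2 P] with ω h2 h3 h4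
  rw [Pi.add_apply, h2, ← h3, h4, Pi.zero_apply, add_zero]

/-- The one-step martingale property of the product N W. In the expansion w(v + d) + ξv + ξd, the
last two terms have zero conditional expectation, since ξ is centred and independent of the past and
d is orthogonal to ξ. -/
theorem IsOrthogonal.condExp_smul_add_eq {hξ : IsUnitNoise m P ξ} {d : Lp V 2 P}
    (hd : IsOrthogonal hξ d) {v : Ω → V} (hv : AEStronglyMeasurable[m] v P) (hv2 : MemLp v 2 P)
    {w : Ω → ℝ} (hw : AEStronglyMeasurable[m] w P) (hw2 : MemLp w 2 P) :
    P[fun ω => (w ω + ξ ω) • (v ω + d ω)|m] =ᵐ[P] fun ω => w ω • v ω := by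
  have hvd : MemLp (v + ⇑d) 2 P := hv2.add (Lp.memLp d)
  have e : (fun ω => (w ω + ξ ω) • (v ω + d ω))
      = w • (v + ⇑d) + ((fun ω => ξ ω • v ω) + fun ω => ξ ω • d ω) := by
    funext ω
    simp only [Pi.add_apply, Pi.smul_apply', add_smul, smul_add]
    abel
  rw [e]
  have i1 := integrable_smul_of_memLp_two hw2 hvd
  have i2 := hξ.integrable_smul hv2
  have i3 := hξ.integrable_smul (Lp.memLp d)
  have h1 := condExp_smul_of_aestronglyMeasurable_left hw i1 (hvd.integrable one_le_two)
  have h2 := hd.condExp_add_eq hv hv2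
  have h3 := noiseAdj_ae_eq hξ d
  rw [hd.noiseAdj_eq_zero] at h3
  filter_upwards [condExp_add i1 (i2.add i3) m, condExp_add i2 i3 m, h1, h2,
    hξ.condExp_smul hv hv2, h3, Lp.coeFn_zero V 2 P] with ω k1 k2 k3 k4 k5 k6 k7
  have k4' : (P[v + ⇑d|m]) ω = v ω := k4
  rw [k1, Pi.add_apply, k2, Pi.add_apply, k3, k5, ← k6, k7, Pi.smul_apply', k4']
  simp

/-- Converse direction: the product ξd is a combination of w'v', wv', w'v and wv, whose conditional
expectations all equal wv and cancel. -/
theorem isOrthogonal_of_condExp (hξ : IsUnitNoise m P ξ) {d : Lp V 2 P} {v v' : Ω → V}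
    {w w' : Ω → ℝ} (hv : AEStronglyMeasurable[m] v P) (hv2 : MemLp v 2 P) (hv2' : MemLp v' 2 P)
    (hw : AEStronglyMeasurable[m] w P) (hw2 : MemLp w 2 P) (hw2' : MemLp w' 2 P)
    (hvm : P[v'|m] =ᵐ[P] v) (hwm : P[w'|m] =ᵐ[P] w) (hwv : P[w' • v'|m] =ᵐ[P] w • v)
    (hd : d =ᵐ[P] v' - v) (hξw : ξ = w' - w) : IsOrthogonal hξ d := by
  constructor
  · apply Lp.ext
    refine (condOp_ae_eq hξ.le d).trans ((condExp_congr_ae hd).trans ?_)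
    filter_upwards [condExp_sub (hv2'.integrable one_le_two) (hv2.integrable one_le_two) m, hvm,
      condExp_of_aestronglyMeasurable' hξ.le hv (hv2.integrable one_le_two),
      Lp.coeFn_zero V 2 P] with ω h1 h2 h3 h4
    rw [h1, Pi.sub_apply, h2, h3, h4, sub_self, Pi.zero_apply]
  · apply Lp.ext
    have e : (fun ω => ξ ω • d ω) =ᵐ[P] (w' • v' - w • v') - (w' • v - w • v) := by
      filter_upwards [hd] with ω h
      rw [h, hξw]
      simp only [Pi.sub_apply, Pi.smul_apply']
      module
    refine (noiseAdj_ae_eq hξ d).trans ((condExp_congr_ae e).trans ?_)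
    have i1 := integrable_smul_of_memLp_two hw2' hv2'
    have i2 := integrable_smul_of_memLp_two hw2 hv2'
    have i3 := integrable_smul_of_memLp_two hw2' hv2
    have i4 := integrable_smul_of_memLp_two hw2 hv2
    filter_upwards [condExp_sub (i1.sub i2) (i3.sub i4) m, condExp_sub i1 i2 m,
      condExp_sub i3 i4 m, hwv,
      condExp_smul_of_aestronglyMeasurable_left hw i2 (hv2'.integrable one_le_two),
      condExp_smul_of_aestronglyMeasurable_right (hw2'.integrable one_le_two) i3 hv,
      condExp_of_aestronglyMeasurable' hξ.le (hw.smul hv) i4, hvm, hwm,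
      Lp.coeFn_zero V 2 P] with ω h1 h2 h3 h4 h5 h6 h7 h8 h9 h10
    rw [h1, Pi.sub_apply, h2, h3, Pi.sub_apply, Pi.sub_apply, h4, h5, h6, h10, Pi.smul_apply',
      Pi.smul_apply', Pi.smul_apply', h8, h9]
    have h7' : (P[w • v|m]) ω = w ω • v ω := h7
    rw [h7', Pi.zero_apply, sub_self]

/-- Connects strong orthogonality, which is stated coordinatewise, with the vector-valued operators.
-/
theorem condExp_euclidean_ae_eq_iff {n : ℕ} {f g : Ω → E n} (hf : Integrable f P) :
    P[f|m] =ᵐ[P] g ↔ ∀ i, P[fun ω => f ω i|m] =ᵐ[P] fun ω => g ω i := by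
  have h : ∀ i, (fun ω => (P[f|m]) ω i) =ᵐ[P] P[fun ω => f ω i|m] := fun i =>
    (EuclideanSpace.proj i : E n →L[ℝ] ℝ).comp_condExp_comm hf
  constructor
  · intro hfg i
    refine (h i).symm.trans ?_
    filter_upwards [hfg] with ω hω
    rw [hω]
  · intro hfg
    filter_upwards [ae_all_iff.2 h, ae_all_iff.2 hfg] with ω h1 h2
    ext i
    rw [h1 i, h2 i]

theorem martingale_of_condExp_succ {T : ℕ} {ℱ : Filtration (Fin (T + 1)) mΩ}
    {f : Fin (T + 1) → Ω → V} (hadp : StronglyAdapted ℱ f) (hint : ∀ t, Integrable (f t) P)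
    (hstep : ∀ t : Fin T, P[f t.succ|ℱ t.castSucc] =ᵐ[P] f t.castSucc) : Martingale f ℱ P := by
  refine ⟨hadp, fun i j hij => ?_⟩
  have hself : ∀ i, P[f i|ℱ i] = f i := fun i =>
    condExp_of_stronglyMeasurable (ℱ.le i) (hadp i) (hint i)
  induction j using Fin.induction with
  | zero =>
    obtain rfl : i = 0 := le_antisymm hij (Fin.zero_le i)
    rw [hself]
  | succ t ih =>
    rcases hij.lt_or_eq with h | rfl
    · have hle : i ≤ t.castSucc := Fin.le_castSucc_iff.2 h
      exact ((condExp_condExp_of_le (ℱ.mono hle) (ℱ.le _)).symm.trans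
        (condExp_congr_ae (hstep t))).trans (ih hle)
    · rw [hself]

end Orthogonality

/-! ### Passage between solutions of the equation and zeros of the L² system. -/

section Translation

set_option linter.unusedSectionVars false

variable {Ω : Type*} {mΩ : MeasurableSpace Ω} {P : Measure Ω} [IsProbabilityMeasure P]
  {T m n : ℕ} {ℱ : Filtration (Fin (T + 1)) mΩ} {W : Fin (T + 1) → Ω → ℝ}

theorem extendZ_castSucc (Z : Fin T → Ω → E n) (t : Fin T) : extendZ Z t.castSucc = Z t := by
  funext ω
  simp [extendZ]

theorem extendZ_last (Z : Fin T → Ω → E n) : extendZ Z (Fin.last T) = 0 := by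
  funext ω
  simp [extendZ]

/-- The processes `X`, `Y`, `Z` are adapted versions of the components of `u`. -/
structure Represents (ℱ : Filtration (Fin (T + 1)) mΩ)
    (u : Unknown T (Lp (E m) 2 P) (Lp (E n) 2 P)) (X : Fin (T + 1) → Ω → E m)
    (Y : Fin (T + 1) → Ω → E n) (Z : Fin T → Ω → E n) : Prop where
  ae_X : ∀ s, X s =ᵐ[P] u.1 s
  ae_Y : ∀ s, Y s =ᵐ[P] u.2.1 s
  ae_Z : ∀ s, extendZ Z s =ᵐ[P] u.2.2 s
  meas_X : ∀ s, StronglyMeasurable[ℱ s] (X s)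
  meas_Y : ∀ s, StronglyMeasurable[ℱ s] (Y s)
  meas_Z : ∀ t : Fin T, StronglyMeasurable[ℱ t.castSucc] (Z t)

/-- The defect prescribed by the initial value `x₀`. -/
noncomputable def initialData (P : Measure Ω) [IsProbabilityMeasure P] (T n : ℕ) {m : ℕ}
    (x₀ : E m) : Unknown T (Lp (E m) 2 P) (Lp (E n) 2 P) :=
  (Fin.cons (α := fun _ => Lp (E m) 2 P) ((memLp_const x₀).toLp) fun _ => 0, 0, 0)

theorem stronglyMeasurable_increment (hW : IsDrivingNoise P ℱ W) (t : Fin T) :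
    StronglyMeasurable[ℱ t.succ] (fun ω => W t.succ ω - W t.castSucc ω) :=
  (hW.martingale.stronglyMeasurable t.succ).sub
    ((hW.martingale.stronglyMeasurable t.castSucc).mono (ℱ.mono Fin.castSucc_lt_succ.le))

namespace Represents

variable {u : Unknown T (Lp (E m) 2 P) (Lp (E n) 2 P)} {X : Fin (T + 1) → Ω → E m}
  {Y : Fin (T + 1) → Ω → E n} {Z : Fin T → Ω → E n} {C : Coefficients Ω T m n} {c : ℝ}
  (G : Matrix (Fin n) (Fin m) ℝ) (β₁ : ℝ)

theorem meas_extendZ (hu : Represents ℱ u X Y Z) (s : Fin (T + 1)) :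
    StronglyMeasurable[ℱ s] (extendZ Z s) := by
  induction s using Fin.lastCases with
  | last => rw [extendZ_last]; exact stronglyMeasurable_zero
  | cast t => rw [extendZ_castSucc]; exact hu.meas_Z t

theorem ae_Z_castSucc (hu : Represents ℱ u X Y Z) (t : Fin T) : Z t =ᵐ[P] u.2.2 t.castSucc := by
  have := hu.ae_Z t.castSucc
  rwa [extendZ_castSucc] at this

theorem b_ae (hu : Represents ℱ u X Y Z) (hW : IsDrivingNoise P ℱ W)
    (hL : C.IsLipschitz P ℱ c) (t : Fin T) :
    (l2Coefficients P G β₁ C).b t (u.1 t.castSucc) (u.2.1 t.castSucc) (u.2.2 t.castSucc)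
      =ᵐ[P] fun ω => C.b t ω (X t.castSucc ω) (Y t.castSucc ω) (Z t ω) := by
  filter_upwards [(hL.b t).superpose_ae_eq (ℱ.le _) hW.measurableSet_of_null'
    (u.1 t.castSucc) (u.2.1 t.castSucc) (u.2.2 t.castSucc), hu.ae_X t.castSucc,
    hu.ae_Y t.castSucc, hu.ae_Z_castSucc t] with ω h1 h2 h3 h4
  simp only [l2Coefficients]
  rw [h1, h2, h3, h4]

theorem σ_ae (hu : Represents ℱ u X Y Z) (hW : IsDrivingNoise P ℱ W)
    (hL : C.IsLipschitz P ℱ c) (t : Fin T) :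
    (l2Coefficients P G β₁ C).σ t (u.1 t.castSucc) (u.2.1 t.castSucc) (u.2.2 t.castSucc)
      =ᵐ[P] fun ω => C.σ t ω (X t.castSucc ω) (Y t.castSucc ω) (Z t ω) := by
  filter_upwards [(hL.σ t).superpose_ae_eq (ℱ.le _) hW.measurableSet_of_null'
    (u.1 t.castSucc) (u.2.1 t.castSucc) (u.2.2 t.castSucc), hu.ae_X t.castSucc,
    hu.ae_Y t.castSucc, hu.ae_Z_castSucc t] with ω h1 h2 h3 h4
  simp only [l2Coefficients]
  rw [h1, h2, h3, h4]

theorem f_ae (hu : Represents ℱ u X Y Z) (hW : IsDrivingNoise P ℱ W)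
    (hL : C.IsLipschitz P ℱ c) (t : Fin T) :
    (l2Coefficients P G β₁ C).f t.succ (u.1 t.succ) (u.2.1 t.succ) (u.2.2 t.succ)
      =ᵐ[P] fun ω => C.f t.succ ω (X t.succ ω) (Y t.succ ω) (extendZ Z t.succ ω) := by
  rw [l2Coefficients_f_succ]
  filter_upwards [(hL.f t).superpose_ae_eq (ℱ.le _) hW.measurableSet_of_null'
    (u.1 t.succ) (u.2.1 t.succ) (u.2.2 t.succ), hu.ae_X t.succ,
    hu.ae_Y t.succ, hu.ae_Z t.succ] with ω h1 h2 h3 h4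
  rw [h1, h2, h3, h4]

theorem h_ae (hu : Represents ℱ u X Y Z) (hW : IsDrivingNoise P ℱ W)
    (hL : C.IsLipschitz P ℱ c) :
    (l2Coefficients P G β₁ C).h (u.1 (Fin.last T))
      =ᵐ[P] fun ω => C.h ω (X (Fin.last T) ω) := by
  filter_upwards [hL.h.superpose_ae_eq (ℱ.le _) hW.measurableSet_of_null'
    (u.1 (Fin.last T)) 0 0, hu.ae_X (Fin.last T)] with ω h1 h2
  simp only [l2Coefficients]
  rw [h1, h2]

theorem aestronglyMeasurable_b (hu : Represents ℱ u X Y Z) (hW : IsDrivingNoise P ℱ W)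
    (hL : C.IsLipschitz P ℱ c) (t : Fin T) :
    AEStronglyMeasurable[ℱ t.castSucc] ((l2Coefficients P G β₁ C).b t (u.1 t.castSucc)
      (u.2.1 t.castSucc) (u.2.2 t.castSucc)) P :=
  ((hL.b t).aestronglyMeasurable (hW.measurableSet_of_null _)
    (hu.meas_X _).aestronglyMeasurable (hu.meas_Y _).aestronglyMeasurable
    (hu.meas_Z t).aestronglyMeasurable).congr (hu.b_ae G β₁ hW hL t).symm

theorem aestronglyMeasurable_σ (hu : Represents ℱ u X Y Z) (hW : IsDrivingNoise P ℱ W)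
    (hL : C.IsLipschitz P ℱ c) (t : Fin T) :
    AEStronglyMeasurable[ℱ t.castSucc] ((l2Coefficients P G β₁ C).σ t (u.1 t.castSucc)
      (u.2.1 t.castSucc) (u.2.2 t.castSucc)) P :=
  ((hL.σ t).aestronglyMeasurable (hW.measurableSet_of_null _)
    (hu.meas_X _).aestronglyMeasurable (hu.meas_Y _).aestronglyMeasurable
    (hu.meas_Z t).aestronglyMeasurable).congr (hu.σ_ae G β₁ hW hL t).symm

theorem aestronglyMeasurable_f (hu : Represents ℱ u X Y Z) (hW : IsDrivingNoise P ℱ W)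
    (hL : C.IsLipschitz P ℱ c) (t : Fin T) :
    AEStronglyMeasurable[ℱ t.succ] ((l2Coefficients P G β₁ C).f t.succ (u.1 t.succ)
      (u.2.1 t.succ) (u.2.2 t.succ)) P :=
  ((hL.f t).aestronglyMeasurable (hW.measurableSet_of_null _)
    (hu.meas_X _).aestronglyMeasurable (hu.meas_Y _).aestronglyMeasurable
    (hu.meas_extendZ _).aestronglyMeasurable).congr (hu.f_ae G β₁ hW hL t).symm

/-- For adapted unknowns the conditional expectation acts as the identity and `noiseOp` as plain
multiplication by ΔW. -/
theorem forward_iff (hu : Represents ℱ u X Y Z) (hW : IsDrivingNoise P ℱ W)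
    (hL : C.IsLipschitz P ℱ c) (t : Fin T) :
    (∀ᵐ ω ∂P, X t.succ ω - X t.castSucc ω
      = C.b t ω (X t.castSucc ω) (Y t.castSucc ω) (Z t ω)
        + (W t.succ ω - W t.castSucc ω) • C.σ t ω (X t.castSucc ω) (Y t.castSucc ω) (Z t ω)) ↔
    u.1 t.succ = (l2Data hW G).E t (u.1 t.castSucc + (l2Coefficients P G β₁ C).b t
        (u.1 t.castSucc) (u.2.1 t.castSucc) (u.2.2 t.castSucc))
      + (l2Data hW G).M t ((l2Coefficients P G β₁ C).σ t
        (u.1 t.castSucc) (u.2.1 t.castSucc) (u.2.2 t.castSucc)) := by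
  set b := (l2Coefficients P G β₁ C).b t (u.1 t.castSucc) (u.2.1 t.castSucc) (u.2.2 t.castSucc)
  set σ := (l2Coefficients P G β₁ C).σ t (u.1 t.castSucc) (u.2.1 t.castSucc) (u.2.2 t.castSucc)
  have hXb : AEStronglyMeasurable[ℱ t.castSucc] (u.1 t.castSucc + b : Lp (E m) 2 P) P :=
    (((hu.meas_X _).aestronglyMeasurable.congr (hu.ae_X _)).add
      (hu.aestronglyMeasurable_b G β₁ hW hL t)).congr (Lp.coeFn_add _ _).symm
  have hE : (l2Data hW G).E t (u.1 t.castSucc + b) = u.1 t.castSucc + b :=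
    condOp_of_aestronglyMeasurable _ hXb
  have hM : (l2Data hW G).M t σ =ᵐ[P] fun ω => (W t.succ ω - W t.castSucc ω) • σ ω :=
    noiseOp_ae_eq_of_aestronglyMeasurable (hW.isUnitNoise t)
      (hu.aestronglyMeasurable_σ G β₁ hW hL t)
  rw [hE, Lp.ext_iff]
  refine Filter.eventually_congr ?_
  filter_upwards [Lp.coeFn_add (u.1 t.castSucc + b) ((l2Data hW G).M t σ),
    Lp.coeFn_add (u.1 t.castSucc) b, hM, hu.b_ae G β₁ hW hL t, hu.σ_ae G β₁ hW hL t,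
    hu.ae_X t.succ, hu.ae_X t.castSucc] with ω h1 h2 h3 h4 h5 h6 h7
  rw [h1, Pi.add_apply, h2, Pi.add_apply, h3, h4, h5, ← h6, ← h7, sub_eq_iff_eq_add', add_assoc]

end Represents

/-- Strong orthogonality of N identifies Y and Z as the conditional mean and the conditional
covariance with ΔW of Y + f one step later; N then no longer appears. Hence uniqueness for the L²
system applies to solutions. -/
theorem IsSolution.exists_represents {C : Coefficients Ω T m n} {c β₁ : ℝ} {x₀ : E m}
    {X : Fin (T + 1) → Ω → E m} {Y : Fin (T + 1) → Ω → E n} {Z : Fin T → Ω → E n}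
    {N : Fin (T + 1) → Ω → E n} (hS : IsSolution P ℱ W C x₀ X Y Z N)
    (hW : IsDrivingNoise P ℱ W) (G : Matrix (Fin n) (Fin m) ℝ) (hL : C.IsLipschitz P ℱ c) :
    ∃ u, Represents ℱ u X Y Z ∧
      residual (l2Data hW G) (l2Coefficients P G β₁ C) u = initialData P T n x₀ := by
  let u : Unknown T (Lp (E m) 2 P) (Lp (E n) 2 P) :=
    (fun s => (hS.adapted_X s).2.toLp, fun s => (hS.adapted_Y s).2.toLp,
      Fin.snoc (α := fun _ => Lp (E n) 2 P) (fun t => (hS.adapted_Z t).2.toLp) 0)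
  have hu : Represents ℱ u X Y Z := by
    refine ⟨fun s => (hS.adapted_X s).2.coeFn_toLp.symm, fun s => (hS.adapted_Y s).2.coeFn_toLp.symm,
      fun s => ?_,
      fun s => (hS.adapted_X s).1, fun s => (hS.adapted_Y s).1, fun t => (hS.adapted_Z t).1⟩
    induction s using Fin.lastCases with
    | last =>
      simp only [u, extendZ_last, Fin.snoc_last]
      exact (Lp.coeFn_zero (E n) 2 P).symm
    | cast t =>
      simp only [u, extendZ_castSucc, Fin.snoc_castSucc]
      exact (hS.adapted_Z t).2.coeFn_toLp.symm
  refine ⟨u, hu, (residual_eq_iff _ _ _ _).2 ⟨?_, fun t => ?_, ?_⟩⟩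
  · apply Lp.ext
    refine (hu.ae_X 0).symm.trans ?_
    filter_upwards [hS.initial, (memLp_const x₀ : MemLp (fun _ : Ω => x₀) 2 P).coeFn_toLp]
      with ω h1 h2
    rw [h1]
    exact h2.symm
  · have h0 : (initialData P T n x₀).1 t.succ = 0 := rfl
    rw [h0, add_zero]
    exact (hu.forward_iff G β₁ hW hL t).1 (hS.forward t)
  have key : ∀ t : Fin T,
      u.2.1 t.castSucc = (l2Data hW G).E' t (u.2.1 t.succ + (l2Coefficients P G β₁ C).f t.succ
        (u.1 t.succ) (u.2.1 t.succ) (u.2.2 t.succ)) ∧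
      u.2.2 t.castSucc = (l2Data hW G).D t (u.2.1 t.succ + (l2Coefficients P G β₁ C).f t.succ
        (u.1 t.succ) (u.2.1 t.succ) (u.2.2 t.succ)) := by
    intro t
    set d : Lp (E n) 2 P := ((hS.adapted_N t.succ).2.sub (hS.adapted_N t.castSucc).2).toLp
    have hd : IsOrthogonal (hW.isUnitNoise t) d := by
      have hle := (Fin.castSucc_lt_succ (i := t)).le
      refine isOrthogonal_of_condExp (hW.isUnitNoise t)
        (hS.adapted_N t.castSucc).1.aestronglyMeasurable (hS.adapted_N t.castSucc).2
        (hS.adapted_N t.succ).2 (hW.martingale.stronglyMeasurable _).aestronglyMeasurable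
        (hW.memLp t.castSucc) (hW.memLp t.succ) (hS.martingale_N.condExp_ae_eq hle)
        (hW.martingale.condExp_ae_eq hle) ?_ (MemLp.coeFn_toLp _) rfl
      refine (condExp_euclidean_ae_eq_iff
        (integrable_smul_of_memLp_two (hW.memLp _) (hS.adapted_N _).2)).2 fun i => ?_
      have := (hS.orthogonal i).condExp_ae_eq hle
      simpa only [Pi.smul_apply', PiLp.smul_apply, smul_eq_mul, mul_comm] using this
    have hY : AEStronglyMeasurable[ℱ t.castSucc] (u.2.1 t.castSucc) P :=
      (hu.meas_Y _).aestronglyMeasurable.congr (hu.ae_Y _)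
    have hZ : AEStronglyMeasurable[ℱ t.castSucc] (u.2.2 t.castSucc) P :=
      (hu.meas_Z _).aestronglyMeasurable.congr (hu.ae_Z_castSucc t)
    -- The backward equation rearranged as the orthogonal decomposition of Y + f at the later time,
    -- whose components are unique.
    have hq : u.2.1 t.succ + (l2Coefficients P G β₁ C).f t.succ
        (u.1 t.succ) (u.2.1 t.succ) (u.2.2 t.succ)
        = u.2.1 t.castSucc + noiseOp (E n) (hW.isUnitNoise t) (u.2.2 t.castSucc) + d := by
      apply Lp.ext
      filter_upwards [Lp.coeFn_add (u.2.1 t.succ) ((l2Coefficients P G β₁ C).f t.succ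
        (u.1 t.succ) (u.2.1 t.succ) (u.2.2 t.succ)), hu.f_ae G β₁ hW hL t, hu.ae_Y t.succ,
        hu.ae_Y t.castSucc, hu.ae_Z_castSucc t,
        Lp.coeFn_add (u.2.1 t.castSucc + noiseOp (E n) (hW.isUnitNoise t) (u.2.2 t.castSucc)) d,
        Lp.coeFn_add (u.2.1 t.castSucc) (noiseOp (E n) (hW.isUnitNoise t) (u.2.2 t.castSucc)),
        noiseOp_ae_eq_of_aestronglyMeasurable (hW.isUnitNoise t) hZ,
        ((hS.adapted_N t.succ).2.sub (hS.adapted_N t.castSucc).2).coeFn_toLp, hS.backward t]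
        with ω h1 h2 h3 h4 h5 h6 h7 h8 h9 h10
      rw [h1, Pi.add_apply, h2, ← h3, h6, Pi.add_apply, h7, Pi.add_apply, h8, ← h4, ← h5, h9,
        Pi.sub_apply]
      generalize C.f t.succ ω (X t.succ ω) (Y t.succ ω) (extendZ Z t.succ ω) = F at h10 ⊢
      rw [sub_eq_iff_eq_add.1 h10]
      abel
    rw [hq]
    obtain ⟨h1, h2⟩ := hd.eq_of_decomposition hY hZ
    exact ⟨h1.symm, h2.symm⟩
  refine ⟨fun t => ?_, fun t => ?_, ?_, ?_⟩
  · exact (key t).1.trans (add_zero _).symm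
  · exact (key t).2.trans (add_zero _).symm
  · have h0 : (initialData P T n x₀).2.1 (Fin.last T) = 0 := rfl
    rw [h0, add_zero]
    apply Lp.ext
    filter_upwards [hu.ae_Y (Fin.last T), hu.h_ae G β₁ hW hL, hS.terminal] with ω h1 h2 h3
    rw [← h1, h2, h3]
  · simp only [u, Fin.snoc_last]
    rfl

/-- Solutions are unique if the system on `L²(P)` is well posed. -/
theorem IsSolution.ae_eq {C : Coefficients Ω T m n} {c β₁ : ℝ} {x₀ : E m}
    {X X' : Fin (T + 1) → Ω → E m} {Y Y' : Fin (T + 1) → Ω → E n} {Z Z' : Fin T → Ω → E n}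
    {N N' : Fin (T + 1) → Ω → E n} (hS : IsSolution P ℱ W C x₀ X Y Z N)
    (hS' : IsSolution P ℱ W C x₀ X' Y' Z' N') (hW : IsDrivingNoise P ℱ W)
    (G : Matrix (Fin n) (Fin m) ℝ) (hL : C.IsLipschitz P ℱ c)
    (hinj : Function.Injective (residual (l2Data hW G) (l2Coefficients P G β₁ C))) :
    (∀ t, X t =ᵐ[P] X' t) ∧ (∀ t, Y t =ᵐ[P] Y' t) ∧
      (∀ t, Z t =ᵐ[P] Z' t) ∧ (∀ t, N t =ᵐ[P] N' t) := by
  obtain ⟨u, hu, hr⟩ := hS.exists_represents (β₁ := β₁) hW G hL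
  obtain ⟨u', hu', hr'⟩ := hS'.exists_represents (β₁ := β₁) hW G hL
  obtain rfl := hinj (hr.trans hr'.symm)
  have hX : ∀ s, X s =ᵐ[P] X' s := fun s => (hu.ae_X s).trans (hu'.ae_X s).symm
  have hY : ∀ s, Y s =ᵐ[P] Y' s := fun s => (hu.ae_Y s).trans (hu'.ae_Y s).symm
  have hZe : ∀ s, extendZ Z s =ᵐ[P] extendZ Z' s := fun s => (hu.ae_Z s).trans (hu'.ae_Z s).symm
  have hZ : ∀ t, Z t =ᵐ[P] Z' t := fun t =>
    (hu.ae_Z_castSucc t).trans (hu'.ae_Z_castSucc t).symm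
  refine ⟨hX, hY, hZ, fun s => ?_⟩
  -- The increments of N are read off from the backward equation, starting from N_0 = 0.
  induction s using Fin.induction with
  | zero =>
    filter_upwards [hS.initial_N, hS'.initial_N] with ω h1 h2
    rw [h1, h2]
  | succ t ih =>
    filter_upwards [ih, hX t.succ, hY t.succ, hY t.castSucc, hZ t, hZe t.succ, hS.backward t,
      hS'.backward t] with ω h1 h2 h3 h4 h5 h6 h7 h8
    rw [h1, h2, h3, h4, h5, h6, h8] at h7
    simpa using h7.symm

/-- A solution of the system on `L²(P)` yields a solution of the difference equation. -/
theorem exists_isSolution {C : Coefficients Ω T m n} {c β₁ : ℝ} {x₀ : E m}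
    (hW : IsDrivingNoise P ℱ W) (G : Matrix (Fin n) (Fin m) ℝ) (hL : C.IsLipschitz P ℱ c)
    {u : Unknown T (Lp (E m) 2 P) (Lp (E n) 2 P)}
    (hu : residual (l2Data hW G) (l2Coefficients P G β₁ C) u = initialData P T n x₀) :
    ∃ X Y Z N, IsSolution P ℱ W C x₀ X Y Z N := by
  obtain ⟨hX0, hX, hY, hZ, hYT, hZT⟩ := (residual_eq_iff _ _ _ _).1 hu
  have hi1 : ∀ t : Fin T, (initialData P T n x₀).1 t.succ = 0 := fun _ => rfl
  have hi2 : ∀ s, (initialData P T n x₀).2.1 s = 0 := fun _ => rfl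
  have hi3 : ∀ s, (initialData P T n x₀).2.2 s = 0 := fun _ => rfl
  simp only [hi1, hi2, hi3, add_zero] at hX hY hZ hYT hZT
  have hlt : ∀ t : Fin T, t.castSucc ≤ t.succ := fun t => Fin.castSucc_lt_succ.le
  -- Adaptedness comes from the equations, whose operators take values in variables of the right
  -- σ-algebra; for Y at time T it holds because ℱ_T is the whole σ-algebra.
  have mX : ∀ s, AEStronglyMeasurable[ℱ s] (u.1 s) P := by
    intro s
    induction s using Fin.cases with
    | zero =>
      rw [hX0]
      exact stronglyMeasurable_const.aestronglyMeasurable.congr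
        (memLp_const x₀ : MemLp (fun _ : Ω => x₀) 2 P).coeFn_toLp.symm
    | succ t =>
      rw [hX t]
      exact (((aestronglyMeasurable_condOp (ℱ.le _) _).mono (ℱ.mono (hlt t))).add
        (aestronglyMeasurable_noiseOp (hW.isUnitNoise t) (ℱ.mono (hlt t))
          (stronglyMeasurable_increment hW t) _)).congr (Lp.coeFn_add _ _).symm
  have mY : ∀ s, AEStronglyMeasurable[ℱ s] (u.2.1 s) P := by
    intro s
    induction s using Fin.lastCases with
    | last =>
      rw [hW.full_last]
      exact (Lp.memLp _).1
    | cast t =>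
      rw [hY t]
      exact aestronglyMeasurable_condOp (ℱ.le _) _
  have mZ : ∀ t : Fin T, AEStronglyMeasurable[ℱ t.castSucc] (u.2.2 t.castSucc) P := by
    intro t
    rw [hZ t]
    exact aestronglyMeasurable_noiseAdj (hW.isUnitNoise t) _
  have hR : Represents ℱ u (fun s => (mX s).mk _) (fun s => (mY s).mk _)
      (fun t => (mZ t).mk _) := by
    refine ⟨fun s => (mX s).ae_eq_mk.symm, fun s => (mY s).ae_eq_mk.symm, fun s => ?_,
      fun s => (mX s).stronglyMeasurable_mk, fun s => (mY s).stronglyMeasurable_mk,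
      fun t => (mZ t).stronglyMeasurable_mk⟩
    induction s using Fin.lastCases with
    | last =>
      rw [extendZ_last, hZT]
      exact (Lp.coeFn_zero (E n) 2 P).symm
    | cast t =>
      rw [extendZ_castSucc]
      exact (mZ t).ae_eq_mk.symm
  set q : Fin T → Lp (E n) 2 P := fun t => u.2.1 t.succ + (l2Coefficients P G β₁ C).f t.succ
    (u.1 t.succ) (u.2.1 t.succ) (u.2.2 t.succ) with hq
  -- The remainder of the one-step decomposition, which is to be the increment of N; `L` sums these
  -- increments from 0.
  set d : Fin T → Lp (E n) 2 P := fun t => q t - u.2.1 t.castSucc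
    - noiseOp (E n) (hW.isUnitNoise t) (u.2.2 t.castSucc) with hd_def
  have hd : ∀ t, IsOrthogonal (hW.isUnitNoise t) (d t) := by
    intro t
    have := isOrthogonal_residual (hW.isUnitNoise t) (q t)
    have e1 : u.2.1 t.castSucc = condOp P (E n) (hW.isUnitNoise t).le (q t) := hY t
    have e2 : u.2.2 t.castSucc = noiseAdj (E n) (hW.isUnitNoise t) (q t) := hZ t
    rw [← e1, ← e2] at this
    exact this
  have md : ∀ t, AEStronglyMeasurable[ℱ t.succ] (d t) P := by
    intro t
    have h1 : AEStronglyMeasurable[ℱ t.succ] (q t) P :=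
      ((mY t.succ).add (hR.aestronglyMeasurable_f G β₁ hW hL t)).congr (Lp.coeFn_add _ _).symm
    have h2 : AEStronglyMeasurable[ℱ t.succ] (q t - u.2.1 t.castSucc : Lp (E n) 2 P) P :=
      (h1.sub ((mY t.castSucc).mono (ℱ.mono (hlt t)))).congr (Lp.coeFn_sub _ _).symm
    exact (h2.sub (aestronglyMeasurable_noiseOp (hW.isUnitNoise t) (ℱ.mono (hlt t))
      (stronglyMeasurable_increment hW t) _)).congr (Lp.coeFn_sub _ _).symm
  obtain ⟨L, hL0, hLs⟩ := exists_forward_recursion (0 : Lp (E n) 2 P) fun t x => x + d t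
  have mL : ∀ s, AEStronglyMeasurable[ℱ s] (L s) P := by
    intro s
    induction s using Fin.induction with
    | zero =>
      rw [hL0]
      exact (aestronglyMeasurable_const (b := (0 : E n))).congr (Lp.coeFn_zero (E n) 2 P).symm
    | succ t ih =>
      rw [hLs t]
      exact ((ih.mono (ℱ.mono (hlt t))).add (md t)).congr (Lp.coeFn_add _ _).symm
  set N : Fin (T + 1) → Ω → E n := fun s => (mL s).mk _ with hN
  have aeN : ∀ s, N s =ᵐ[P] L s := fun s => (mL s).ae_eq_mk.symm
  have memN : ∀ s, MemLp (N s) 2 P := fun s => (Lp.memLp (L s)).ae_eq (aeN s).symm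
  have measN : ∀ s, StronglyMeasurable[ℱ s] (N s) := fun s => (mL s).stronglyMeasurable_mk
  have stepN : ∀ t : Fin T, N t.succ =ᵐ[P] fun ω => N t.castSucc ω + d t ω := by
    intro t
    have e : L t.succ =ᵐ[P] (L t.castSucc + d t : Lp (E n) 2 P) := by rw [hLs t]
    filter_upwards [(aeN t.succ).trans e, Lp.coeFn_add (L t.castSucc) (d t), aeN t.castSucc] with ω h1 h2 h3
    rw [h1, h2, Pi.add_apply, h3]
  refine ⟨_, _, _, N, ⟨fun s => ⟨hR.meas_X s, (Lp.memLp _).ae_eq (hR.ae_X s).symm⟩,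
    fun s => ⟨hR.meas_Y s, (Lp.memLp _).ae_eq (hR.ae_Y s).symm⟩,
    fun t => ⟨hR.meas_Z t, (Lp.memLp _).ae_eq (hR.ae_Z_castSucc t).symm⟩,
    fun s => ⟨measN s, memN s⟩, fun t => (hR.forward_iff G β₁ hW hL t).2 (hX t), fun t => ?_,
    ?_, ?_, ?_, fun i => ?_, ?_⟩⟩
  · filter_upwards [stepN t, Lp.coeFn_sub (q t - u.2.1 t.castSucc)
      (noiseOp (E n) (hW.isUnitNoise t) (u.2.2 t.castSucc)),
      Lp.coeFn_sub (q t) (u.2.1 t.castSucc),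
      noiseOp_ae_eq_of_aestronglyMeasurable (hW.isUnitNoise t) (mZ t),
      Lp.coeFn_add (u.2.1 t.succ) ((l2Coefficients P G β₁ C).f t.succ
        (u.1 t.succ) (u.2.1 t.succ) (u.2.2 t.succ)), hR.f_ae G β₁ hW hL t, hR.ae_Y t.succ,
      hR.ae_Y t.castSucc, hR.ae_Z_castSucc t] with ω h1 h2 h3 h4 h5 h6 h7 h8 h9
    rw [h1, h2, Pi.sub_apply, h3, Pi.sub_apply, h4, h5, Pi.add_apply, h6, h7, h8, h9]
    abel
  · have e : u.1 0 =ᵐ[P] fun _ => x₀ := by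
      rw [hX0]
      exact (memLp_const x₀ : MemLp (fun _ : Ω => x₀) 2 P).coeFn_toLp
    exact (hR.ae_X 0).trans e
  · have e : u.2.1 (Fin.last T) =ᵐ[P]
        (l2Coefficients P G β₁ C).h (u.1 (Fin.last T)) := by rw [hYT]
    exact ((hR.ae_Y (Fin.last T)).trans e).trans (hR.h_ae G β₁ hW hL)
  · refine martingale_of_condExp_succ measN (fun s => (memN s).integrable one_le_two) fun t => ?_
    exact (condExp_congr_ae (stepN t)).trans
      ((hd t).condExp_add_eq (measN _).aestronglyMeasurable (memN _))
  · refine martingale_of_condExp_succ (fun s => ?_) (fun s => ?_) fun t => ?_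
    · exact ((EuclideanSpace.proj i : E n →L[ℝ] ℝ).continuous.comp_stronglyMeasurable
        (measN s)).mul (hW.martingale.stronglyMeasurable s)
    · exact ((EuclideanSpace.proj i : E n →L[ℝ] ℝ).comp_memLp' (memN s)).integrable_mul (hW.memLp s)
    · have h1 := (hd t).condExp_smul_add_eq (measN t.castSucc).aestronglyMeasurable
        (memN t.castSucc) (hW.martingale.stronglyMeasurable t.castSucc).aestronglyMeasurable
        (hW.memLp t.castSucc)
      have h2 : (W t.succ • N t.succ) =ᵐ[P] fun ω => (W t.castSucc ω
          + (W t.succ ω - W t.castSucc ω)) • (N t.castSucc ω + d t ω) := by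
        filter_upwards [stepN t] with ω h
        rw [Pi.smul_apply', h, add_sub_cancel]
      have h3 := (condExp_euclidean_ae_eq_iff
        (integrable_smul_of_memLp_two (hW.memLp _) (memN _))).1 ((condExp_congr_ae h2).trans h1) i
      simpa only [Pi.smul_apply', PiLp.smul_apply, smul_eq_mul, mul_comm] using h3
  · have e : L 0 =ᵐ[P] (0 : Ω → E n) := by
      rw [hL0]
      exact Lp.coeFn_zero (E n) 2 P
    exact (aeN 0).trans e

end Translation

end FBSDelta

theorem mainTheorem1 {Ω : Type*} {mΩ : MeasurableSpace Ω} (P : Measure Ω)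
    [IsProbabilityMeasure P] {T m n : ℕ} (ℱ : Filtration (Fin (T + 1)) mΩ)
    (W : Fin (T + 1) → Ω → ℝ) (hW : FBSDelta.IsDrivingNoise P ℱ W)
    (G : Matrix (Fin n) (Fin m) ℝ) (hG : G.rank = min n m)
    (β₁ β₂ : ℝ) (hβ₁ : 0 ≤ β₁) (hβ₂ : 0 ≤ β₂) (hβ : 0 < β₁ + β₂)
    (hnm : m < n → 0 < β₁) (hmn : n < m → 0 < β₂)
    (C : FBSDelta.Coefficients Ω T m n) (hC : FBSDelta.Assumptions P ℱ G β₁ β₂ C)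
    (x₀ : FBSDelta.E m) :
    (∃ (X : Fin (T + 1) → Ω → FBSDelta.E m) (Y : Fin (T + 1) → Ω → FBSDelta.E n)
        (Z : Fin T → Ω → FBSDelta.E n) (N : Fin (T + 1) → Ω → FBSDelta.E n),
        FBSDelta.IsSolution P ℱ W C x₀ X Y Z N) ∧
      (∀ (X X' : Fin (T + 1) → Ω → FBSDelta.E m) (Y Y' : Fin (T + 1) → Ω → FBSDelta.E n)
        (Z Z' : Fin T → Ω → FBSDelta.E n) (N N' : Fin (T + 1) → Ω → FBSDelta.E n),
        FBSDelta.IsSolution P ℱ W C x₀ X Y Z N →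
        FBSDelta.IsSolution P ℱ W C x₀ X' Y' Z' N' →
        (∀ t, X t =ᵐ[P] X' t) ∧ (∀ t, Y t =ᵐ[P] Y' t) ∧
          (∀ t, Z t =ᵐ[P] Z' t) ∧ (∀ t, N t =ᵐ[P] N' t)) := by
  obtain ⟨c, -, hL⟩ := hC.exists_isLipschitz
  have hbij := FBSDelta.l2_residual_bijective hW G hG hβ₁ hβ₂ hβ hnm hmn hC
  refine ⟨?_, fun X X' Y Y' Z Z' N N' hS hS' => hS.ae_eq hS' hW G hL hbij.1⟩
  obtain ⟨u, hu⟩ := hbij.2 (FBSDelta.initialData P T n x₀)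
  exact FBSDelta.exists_isSolution hW G hL hu
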